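/- Let $(D,G)$ be a group pair: $D$ is a connected finite-dimensional real Lie group whose Lie algebra $\mathfrak d$ (with the bracket of right-invariant vector fields) carries a nondegenerate symmetric ad-invariant bilinear form $\langle\cdot,\cdot\rangle$, and $G\subset D$ is a connected closed Lie subgroup whose Lie algebra $\mathfrak g\subset\mathfrak d$ is isotropic with $\dim\mathfrak d=2\dim\mathfrak g$. Let $j:\mathfrak g^*\to\mathfrak d$ be an isotropic splitting, that is, a linear map with $\langle j\mu,j\nu\rangle=0$ and $\langle j\mu,v\rangle=\mu(v)$ for $\mu,\nu\in\mathfrak g^*$, $v\in\mathfrak g$, and put $$F(v)(\mu,\nu)=\langle[j\mu,j\nu],v\rangle,\qquad \chi(\mu,\nu,\lambda)=\langle[j\mu,j\nu],j\lambda\rangle .$$ Let $S=D/G$, with the dressing action of $D$ by left multiplication and infinitesimal action $\rho_S:\mathfrak d\to\mathfrak X(S)$, and let $\sigma^\vee=(\rho_S j)^*:T^*S\to\mathfrak g$. Let $(M,\pi,\rho_M,J)$ be a Hamiltonian quasi-Poisson $G$-space: $M$ is a smooth manifold with a smooth $G$-action, whose infinitesimal action is $\rho_M:\mathfrak g\to\mathfrak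 X(M)$, $\pi$ is a bivector field on $M$ with $$\mathcal L_{\rho_M(v)}\pi=-\rho_M(F(v))\ \ (v\in\mathfrak g),\qquad \tfrac12[\pi,\pi]=\rho_M(\chi),$$ and $J:M\to S$ is a smooth $G$-equivariant map with $\pi^\sharp J^*=\rho_M\sigma^\vee$. Let $y\in S$ be a regular value of $J$ and let $\mathcal O=G\cdot y$ be its dressing orbit. Regard $J^{-1}(\mathcal O)$ as an immersed submanifold of $M$, with the topology of $M\times_S\mathcal O$, where $\mathcal O\cong G/G_y$ carries the quotient topology. Then the algebra $C^\infty(J^{-1}(\mathcal O))^G$ of $G$-invariant smooth functions on $J^{-1}(\mathcal O)$ is a Poisson algebra: there is a unique Poisson bracket on it such that $$\{f,g\}(p)=\pi(d\tilde f,d\tilde g)(p)$$ for all $p\in J^{-1}(\mathcal O)$ and all $\tilde f,\tilde g\in C^\infty(M)$ which agree with $f,g$ on a neighbourhood of $p$ in $J^{-1}(\mathcal O)$; in particular the right-hand side does not depend on the choice of such extensions. Moreover, if the $G$-action on $J^{-1}(\mathcal O)$ is free and proper, then $J^{-1}(\mathcal O)/G$, with the quotient topology, is a Poisson manifold: it has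 the structure of a (Hausdorff, second countable) smooth manifold for which a function is smooth if and only if its pull-back to $J^{-1}(\mathcal O)$ is smooth, and $C^\infty(J^{-1}(\mathcal O)/G)$ carries a unique Poisson bracket such that pull-back to $C^\infty(J^{-1}(\mathcal O))^G$ preserves brackets. -/

import Mathlib

open scoped Manifold ContDiff Topology

noncomputable section

namespace QuasiPoisson

/-! ### Poisson algebras -/

/-- A Poisson bracket on a commutative `ℝ`-algebra: a Lie bracket which is a derivation in each
argument. -/
@[ext]
structure PoissonBracket (A : Type*) [CommRing A] [Algebra ℝ A] where
  bracket : A →ₗ[ℝ] A →ₗ[ℝ] A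
  bracket_self : ∀ f : A, bracket f f = 0
  jacobi : ∀ f g h : A,
    bracket f (bracket g h) + bracket g (bracket h f) + bracket h (bracket f g) = 0
  leibniz : ∀ f g h : A, bracket f (g * h) = bracket f g * h + g * bracket f h

/-! ### Bivector fields on a manifold -/

section Bivector

/-- A smooth bivector field `π` on `M`, given by the bundle map `π♯ : T*M → TM`,
`β (π♯ α) = π (α, β)`. Smoothness is tested on differentials of smooth functions, which span
every cotangent space. -/
structure BivectorField (EM : Type*) [NormedAddCommGroup EM] [NormedSpace ℝ EM]
    (M : Type*) [TopologicalSpace M] [ChartedSpace EM M] where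
  sharp : ∀ x : M, (TangentSpace 𝓘(ℝ, EM) x →L[ℝ] ℝ) →ₗ[ℝ] TangentSpace 𝓘(ℝ, EM) x
  skew : ∀ (x : M) (α : TangentSpace 𝓘(ℝ, EM) x →L[ℝ] ℝ), α (sharp x α) = 0
  smooth : ∀ f g : M → ℝ, ContMDiff 𝓘(ℝ, EM) 𝓘(ℝ, ℝ) ∞ f → ContMDiff 𝓘(ℝ, EM) 𝓘(ℝ, ℝ) ∞ g →
    ContMDiff 𝓘(ℝ, EM) 𝓘(ℝ, ℝ) ∞
      (fun x => mvfderiv 𝓘(ℝ, EM) g x (sharp x (mvfderiv 𝓘(ℝ, EM) f x)))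

variable {EM : Type*} [NormedAddCommGroup EM] [NormedSpace ℝ EM]
  {M : Type*} [TopologicalSpace M] [ChartedSpace EM M]

/-- The function `{f, g} = π (df, dg)`. -/
def BivectorField.bracket (π : BivectorField EM M) (f g : M → ℝ) : M → ℝ :=
  fun x => mvfderiv 𝓘(ℝ, EM) g x (π.sharp x (mvfderiv 𝓘(ℝ, EM) f x))

/-- The derivative `X f` of a function along a vector field. -/
def derivAlong (X : ∀ x : M, TangentSpace 𝓘(ℝ, EM) x) (f : M → ℝ) : M → ℝ :=
  fun x => mvfderiv 𝓘(ℝ, EM) f x (X x)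

/-- The value `(𝓛_X π) (df, dg) = X (π (df, dg)) - π (d (X f), dg) - π (df, d (X g))` of the Lie
derivative of a bivector field. -/
def BivectorField.lieDerivative (π : BivectorField EM M)
    (X : ∀ x : M, TangentSpace 𝓘(ℝ, EM) x) (f g : M → ℝ) : M → ℝ :=
  derivAlong X (π.bracket f g) - π.bracket (derivAlong X f) g - π.bracket f (derivAlong X g)

/-- The value `[π, τ] (df, dg, dh)` of the Schouten bracket of two bivector fields; in particular
`½ [π, π] (df, dg, dh) = {f, {g, h}} + {g, {h, f}} + {h, {f, g}}`. -/
def BivectorField.schouten (π τ : BivectorField EM M) (f g h : M → ℝ) : M → ℝ :=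
  π.bracket f (τ.bracket g h) + π.bracket g (τ.bracket h f) + π.bracket h (τ.bracket f g)
    + (τ.bracket f (π.bracket g h) + τ.bracket g (π.bracket h f) + τ.bracket h (π.bracket f g))

end Bivector

/-! ### The Lie algebra of a Lie group, and fundamental vector fields -/

section LieAlgebra

variable {ED : Type*} [NormedAddCommGroup ED] [NormedSpace ℝ ED]
  {D : Type*} [TopologicalSpace D] [ChartedSpace ED D] [Group D]

/-- The right-invariant vector field `a ↦ d(r_a) u` of `u ∈ T_1 D`. -/
def rightInvariantField (u : GroupLieAlgebra 𝓘(ℝ, ED) D) (a : D) :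
    TangentSpace 𝓘(ℝ, ED) a :=
  mfderiv 𝓘(ℝ, ED) 𝓘(ℝ, ED) (fun b : D => b * a) 1 u

/-- The Lie bracket on `T_1 D` obtained from *right*-invariant vector fields (so that the
fundamental vector fields of a left action form a Lie algebra homomorphism). It is minus Mathlib's
bracket on `GroupLieAlgebra`, which uses left-invariant vector fields. -/
def lieBracketR (u v : GroupLieAlgebra 𝓘(ℝ, ED) D) : GroupLieAlgebra 𝓘(ℝ, ED) D :=
  VectorField.mlieBracket 𝓘(ℝ, ED) (rightInvariantField u) (rightInvariantField v) (1 : D)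

variable {EM : Type*} [NormedAddCommGroup EM] [NormedSpace ℝ EM]
  {M : Type*} [TopologicalSpace M] [ChartedSpace EM M] [MulAction D M]

variable (ED D EM) in
/-- The infinitesimal action at `x`: `u ↦ d/dt|₀ exp (t u) • x`, i.e. the derivative at `1` of
the orbit map `a ↦ a • x`. -/
def infAction (x : M) : GroupLieAlgebra 𝓘(ℝ, ED) D →L[ℝ] TangentSpace 𝓘(ℝ, EM) x :=
  mfderiv 𝓘(ℝ, ED) 𝓘(ℝ, EM) (fun a : D => a • x) 1

end LieAlgebra

instance {EG : Type*} [NormedAddCommGroup EG] [NormedSpace ℝ EG] [FiniteDimensional ℝ EG]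
    {G : Type*} [TopologicalSpace G] [ChartedSpace EG G] (x : G) :
    FiniteDimensional ℝ (TangentSpace 𝓘(ℝ, EG) x) :=
  inferInstanceAs (FiniteDimensional ℝ EG)

/-! ### Split Manin pairs, integrated by group pairs -/

/-- The derivative at the identity of a group homomorphism. -/
def lieMap {EG : Type*} [NormedAddCommGroup EG] [NormedSpace ℝ EG]
    {G : Type*} [TopologicalSpace G] [ChartedSpace EG G] [Group G]
    {ED : Type*} [NormedAddCommGroup ED] [NormedSpace ℝ ED]
    {D : Type*} [TopologicalSpace D] [ChartedSpace ED D] [Group D] (φ : G →* D) :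
    GroupLieAlgebra 𝓘(ℝ, EG) G →L[ℝ] GroupLieAlgebra 𝓘(ℝ, ED) D :=
  mfderiv 𝓘(ℝ, EG) 𝓘(ℝ, ED) φ 1

/-- A split Manin pair `(𝔡, 𝔤, j)` together with a group pair `(D, G)` integrating it:
`G` is a closed Lie subgroup of `D` (via `incl`), `𝔡 = Lie D` carries a nondegenerate symmetric
invariant bilinear form, `𝔤 = Lie G` is isotropic of half the dimension (so that the form has
signature `(n, n)` and `𝔤` is maximal isotropic), and `j : 𝔤* → 𝔡` is an isotropic
splitting of `𝔤 → 𝔡 → 𝔤*`. -/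
structure SplitManinPair (ED : Type*) [NormedAddCommGroup ED] [NormedSpace ℝ ED]
    (D : Type*) [TopologicalSpace D] [ChartedSpace ED D] [Group D]
    (EG : Type*) [NormedAddCommGroup EG] [NormedSpace ℝ EG]
    (G : Type*) [TopologicalSpace G] [ChartedSpace EG G] [Group G] where
  incl : G →* D
  incl_smooth : ContMDiff 𝓘(ℝ, EG) 𝓘(ℝ, ED) ∞ incl
  incl_closed : Topology.IsClosedEmbedding incl
  incl_immersion : Function.Injective
    (lieMap incl : GroupLieAlgebra 𝓘(ℝ, EG) G →L[ℝ] GroupLieAlgebra 𝓘(ℝ, ED) D)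
  form : LinearMap.BilinForm ℝ (GroupLieAlgebra 𝓘(ℝ, ED) D)
  form_symm : form.IsSymm
  form_nondegenerate : form.Nondegenerate
  form_invariant : ∀ u v w : GroupLieAlgebra 𝓘(ℝ, ED) D,
    form (lieBracketR u v) w = form u (lieBracketR v w)
  isotropic : ∀ u v : GroupLieAlgebra 𝓘(ℝ, EG) G, form (lieMap incl u) (lieMap incl v) = 0
  finrank_eq : Module.finrank ℝ ED = 2 * Module.finrank ℝ EG
  j : Module.Dual ℝ (GroupLieAlgebra 𝓘(ℝ, EG) G) →ₗ[ℝ] GroupLieAlgebra 𝓘(ℝ, ED) D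
  j_isotropic : ∀ μ ν, form (j μ) (j ν) = 0
  j_splitting : ∀ (μ : Module.Dual ℝ (GroupLieAlgebra 𝓘(ℝ, EG) G))
    (v : GroupLieAlgebra 𝓘(ℝ, EG) G), form (j μ) (lieMap incl v) = μ v

namespace SplitManinPair

variable {ED : Type*} [NormedAddCommGroup ED] [NormedSpace ℝ ED]
  {D : Type*} [TopologicalSpace D] [ChartedSpace ED D] [Group D]
  {EG : Type*} [NormedAddCommGroup EG] [NormedSpace ℝ EG]
  {G : Type*} [TopologicalSpace G] [ChartedSpace EG G] [Group G]
  (P : SplitManinPair ED D EG G)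

/-- The cobracket: `F(v) (μ, ν) = ⟨v, F*(μ, ν)⟩` with `F*(μ, ν) = ι* [j μ, j ν]`. -/
def cobracket (v : GroupLieAlgebra 𝓘(ℝ, EG) G)
    (μ ν : Module.Dual ℝ (GroupLieAlgebra 𝓘(ℝ, EG) G)) : ℝ :=
  P.form (lieBracketR (P.j μ) (P.j ν)) (lieMap P.incl v)

/-- The trivector `χ (μ, ν, lam) = ⟨j* [j μ, j ν], lam⟩ = ⟨[j μ, j ν], j lam⟩`. -/
def trivector (μ ν lam : Module.Dual ℝ (GroupLieAlgebra 𝓘(ℝ, EG) G)) : ℝ :=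
  P.form (lieBracketR (P.j μ) (P.j ν)) (P.j lam)

/-- The space `S = D / G` of left cosets `a G`, with the quotient topology and the dressing action
of `D` by left multiplication. -/
abbrev S : Type _ := D ⧸ P.incl.range

/-- The map `σ^∨ = (ρ_S ∘ j)* : T*_s S → 𝔤** = 𝔤`. -/
def sigmaDual [FiniteDimensional ℝ EG] {ES : Type*} [NormedAddCommGroup ES] [NormedSpace ℝ ES]
    [ChartedSpace ES P.S] (s : P.S) (α : TangentSpace 𝓘(ℝ, ES) s →L[ℝ] ℝ) :
    GroupLieAlgebra 𝓘(ℝ, EG) G :=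
  (Module.evalEquiv ℝ (GroupLieAlgebra 𝓘(ℝ, EG) G)).symm
    (α.toLinearMap ∘ₗ (infAction ED D ES s).toLinearMap ∘ₗ P.j)

/-- The `G`-orbit of `y` under the dressing action. -/
def DressingOrbit (y : P.S) : Type _ := {s : P.S // ∃ g : G, P.incl g • y = s}

/-- The dressing orbit is an immersed, possibly not embedded, submanifold `G / G_y` of `S`. It is
given its own topology, the quotient topology along the orbit map `G → 𝒪`. -/
instance (y : P.S) : TopologicalSpace (P.DressingOrbit y) :=
  TopologicalSpace.coinduced (fun g : G => (⟨P.incl g • y, g, rfl⟩ : P.DressingOrbit y))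
    inferInstance

end SplitManinPair

/-! ### Hamiltonian quasi-Poisson spaces -/

/-- A Hamiltonian quasi-Poisson `G`-space `(M, π, ρ_M, J)` for the split Manin pair `P`; the
action `ρ_M` of `𝔤` is the infinitesimal action of the `G`-action on `M`. -/
structure HamiltonianSpace {ED : Type*} [NormedAddCommGroup ED] [NormedSpace ℝ ED]
    {D : Type*} [TopologicalSpace D] [ChartedSpace ED D] [Group D]
    {EG : Type*} [NormedAddCommGroup EG] [NormedSpace ℝ EG] [FiniteDimensional ℝ EG]
    {G : Type*} [TopologicalSpace G] [ChartedSpace EG G] [Group G]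
    (P : SplitManinPair ED D EG G)
    (ES : Type*) [NormedAddCommGroup ES] [NormedSpace ℝ ES] [ChartedSpace ES P.S]
    (EM : Type*) [NormedAddCommGroup EM] [NormedSpace ℝ EM]
    (M : Type*) [TopologicalSpace M] [ChartedSpace EM M] [MulAction G M] where
  π : BivectorField EM M
  /-- `𝓛_{ρ_M(v)} π = - ρ_M(F(v))` -/
  lie_eq : ∀ (v : GroupLieAlgebra 𝓘(ℝ, EG) G) (f g : M → ℝ),
    ContMDiff 𝓘(ℝ, EM) 𝓘(ℝ, ℝ) ∞ f → ContMDiff 𝓘(ℝ, EM) 𝓘(ℝ, ℝ) ∞ g → ∀ x : M,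
    π.lieDerivative (fun x => infAction EG G EM x v) f g x =
      - P.cobracket v (mvfderiv 𝓘(ℝ, EM) f x ∘L infAction EG G EM x).toLinearMap
          (mvfderiv 𝓘(ℝ, EM) g x ∘L infAction EG G EM x).toLinearMap
  /-- `½ [π, π] = ρ_M(χ)` -/
  schouten_eq : ∀ f g h : M → ℝ,
    ContMDiff 𝓘(ℝ, EM) 𝓘(ℝ, ℝ) ∞ f → ContMDiff 𝓘(ℝ, EM) 𝓘(ℝ, ℝ) ∞ g →
    ContMDiff 𝓘(ℝ, EM) 𝓘(ℝ, ℝ) ∞ h → ∀ x : M,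
    (1 / 2 : ℝ) * π.schouten π f g h x =
      P.trivector (mvfderiv 𝓘(ℝ, EM) f x ∘L infAction EG G EM x).toLinearMap
        (mvfderiv 𝓘(ℝ, EM) g x ∘L infAction EG G EM x).toLinearMap
        (mvfderiv 𝓘(ℝ, EM) h x ∘L infAction EG G EM x).toLinearMap
  /-- The moment map. -/
  J : M → P.S
  J_smooth : ContMDiff 𝓘(ℝ, EM) 𝓘(ℝ, ES) ∞ J
  J_equivariant : ∀ (g : G) (x : M), J (g • x) = P.incl g • J x
  /-- `π♯ J* = ρ_M σ^∨` -/
  moment : ∀ (x : M) (α : TangentSpace 𝓘(ℝ, ES) (J x) →L[ℝ] ℝ),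
    π.sharp x (α ∘L mfderiv 𝓘(ℝ, EM) 𝓘(ℝ, ES) J x) =
      infAction EG G EM x (P.sigmaDual (J x) α)

namespace HamiltonianSpace

variable {ED : Type*} [NormedAddCommGroup ED] [NormedSpace ℝ ED]
  {D : Type*} [TopologicalSpace D] [ChartedSpace ED D] [Group D]
  {EG : Type*} [NormedAddCommGroup EG] [NormedSpace ℝ EG] [FiniteDimensional ℝ EG]
  {G : Type*} [TopologicalSpace G] [ChartedSpace EG G] [Group G]
  {P : SplitManinPair ED D EG G}
  {ES : Type*} [NormedAddCommGroup ES] [NormedSpace ℝ ES] [ChartedSpace ES P.S]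
  {EM : Type*} [NormedAddCommGroup EM] [NormedSpace ℝ EM]
  {M : Type*} [TopologicalSpace M] [ChartedSpace EM M] [MulAction G M]
  (H : HamiltonianSpace P ES EM M)

/-- `y` is a regular value of `J`. -/
def IsRegularValue (y : P.S) : Prop :=
  ∀ x : M, H.J x = y → Function.Surjective (mfderiv 𝓘(ℝ, EM) 𝓘(ℝ, ES) H.J x)

/-- The preimage `J⁻¹(𝒪)` of the dressing orbit `𝒪` of `y`. -/
def Preimage (y : P.S) : Type _ := {x : M // ∃ g : G, P.incl g • y = H.J x}

/-- The restriction `J : J⁻¹(𝒪) → 𝒪`. -/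
def toOrbit (y : P.S) (p : H.Preimage y) : P.DressingOrbit y := ⟨H.J p.1, p.2⟩

/-- The topology of `J⁻¹(𝒪)` as an immersed submanifold, namely as the fibre product
`M ×_S 𝒪`. If `𝒪` is embedded in `S` this is the subspace topology. -/
instance (y : P.S) : TopologicalSpace (H.Preimage y) :=
  TopologicalSpace.induced Subtype.val inferInstance ⊓
    TopologicalSpace.induced (H.toOrbit y) inferInstance

/-- `G` acts on `J⁻¹(𝒪)` by restriction of its action on `M`. -/
instance (y : P.S) : MulAction G (H.Preimage y) where
  smul g p := ⟨g • p.1, by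
    obtain ⟨h, hh⟩ := p.2
    exact ⟨g * h, by rw [map_mul, mul_smul, hh, H.J_equivariant]⟩⟩
  one_smul p := Subtype.ext (one_smul G p.1)
  mul_smul g h p := Subtype.ext (mul_smul g h p.1)

variable {H} in
/-- `F` is a smooth function on `M` which extends `f : J⁻¹(𝒪) → ℝ` near `p`: it agrees with `f`
on a neighbourhood of `p` in the immersed submanifold `J⁻¹(𝒪)`. -/
def IsExtensionAt {y : P.S} (F : M → ℝ) (f : H.Preimage y → ℝ) (p : H.Preimage y) : Prop :=
  ContMDiff 𝓘(ℝ, EM) 𝓘(ℝ, ℝ) ∞ F ∧ ∀ᶠ q in 𝓝 p, F q.1 = f q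

variable {H} in
/-- Smooth functions on the immersed submanifold `J⁻¹(𝒪)` of `M`: those which locally, in the
topology of `J⁻¹(𝒪)`, are restrictions of smooth functions on `M`. -/
def IsSmooth {y : P.S} (f : H.Preimage y → ℝ) : Prop :=
  ∀ p : H.Preimage y, ∃ F : M → ℝ, IsExtensionAt F f p

/-- The algebra `C^∞(J⁻¹(𝒪))^G` of `G`-invariant smooth functions. -/
def invariantFunctions (y : P.S) : Subalgebra ℝ (H.Preimage y → ℝ) where
  carrier := {f | IsSmooth f ∧ ∀ (g : G) (p : H.Preimage y), f (g • p) = f p}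
  mul_mem' := by
    rintro f g ⟨hf, hf'⟩ ⟨hg, hg'⟩
    refine ⟨fun p => ?_, fun a p => by simp only [Pi.mul_apply, hf', hg']⟩
    obtain ⟨F, hF, hF'⟩ := hf p
    obtain ⟨K, hK, hK'⟩ := hg p
    refine ⟨F * K, hF.mul hK, ?_⟩
    filter_upwards [hF', hK'] with q h1 h2
    simp only [Pi.mul_apply, h1, h2]
  add_mem' := by
    rintro f g ⟨hf, hf'⟩ ⟨hg, hg'⟩
    refine ⟨fun p => ?_, fun a p => by simp only [Pi.add_apply, hf', hg']⟩
    obtain ⟨F, hF, hF'⟩ := hf p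
    obtain ⟨K, hK, hK'⟩ := hg p
    refine ⟨F + K, hF.add hK, ?_⟩
    filter_upwards [hF', hK'] with q h1 h2
    simp only [Pi.add_apply, h1, h2]
  algebraMap_mem' := fun c =>
    ⟨fun _ => ⟨fun _ => c, contMDiff_const, Filter.Eventually.of_forall fun _ => rfl⟩,
      fun _ _ => rfl⟩

/-- A Poisson bracket on `C^∞(J⁻¹(𝒪))^G` is the reduced one if `{f, g} = π (dF, dK)` at every
point of `J⁻¹(𝒪)`, for *all* extensions `F`, `K` of `f`, `g` near that point. -/
def IsReducedBracket {y : P.S} (br : PoissonBracket (H.invariantFunctions y)) : Prop :=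
  ∀ (f g : H.invariantFunctions y) (p : H.Preimage y) (F K : M → ℝ),
    IsExtensionAt F f.1 p → IsExtensionAt K g.1 p →
      (br.bracket f g).1 p = H.π.bracket F K p.1

/-- The quotient `J⁻¹(𝒪) / G`, with the quotient topology. -/
abbrev ReducedSpace (y : P.S) : Type _ := MulAction.orbitRel.Quotient G (H.Preimage y)

/-- The projection `J⁻¹(𝒪) → J⁻¹(𝒪) / G`. -/
def proj {y : P.S} (p : H.Preimage y) : H.ReducedSpace y := Quotient.mk _ p

end HamiltonianSpace

end QuasiPoisson

end

/-!
Since `J` is a submersion along `J⁻¹(𝒪)`, the differential at `p` of a function which vanishes on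
`J⁻¹(𝒪)` near `p` is a pull-back `J*α`, and the moment map condition `π♯ J* = ρ_M σ^∨` makes its
Hamiltonian vector field tangent to the `G`-orbits. An invariant function does not change along
the orbits, so `π(dF, dK)(p)` depends only on the restrictions of `F` and `K` to `J⁻¹(𝒪)`. The
right-hand sides `ρ_M(F(v))` and `ρ_M(χ)` of the two quasi-Poisson identities also vanish on
invariant functions: the first identity gives the invariance of the reduced bracket, the second its
Jacobi identity.

If the action on `J⁻¹(𝒪)` is free and proper, let `J(p) = y`. The fibre `J⁻¹(y)` is a manifold near
`p`, and a complement of the `G_y`-orbit in it is a slice to the `G`-orbits in `J⁻¹(𝒪)`. Freeness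
makes `ρ_M` injective at `p`, properness separates the orbits through nearby points of the slice,
and the slices are the charts of the quotient.
-/

namespace QuasiPoisson

open Filter Function Module

/-! ### Smooth maps near a point -/

section SmoothNear

variable {E : Type*} [NormedAddCommGroup E] [NormedSpace ℝ E]
  {H : Type*} [TopologicalSpace H] {I : ModelWithCorners ℝ E H}
  {X : Type*} [TopologicalSpace X] [ChartedSpace H X]
  {E' : Type*} [NormedAddCommGroup E'] [NormedSpace ℝ E']
  {H' : Type*} [TopologicalSpace H'] {I' : ModelWithCorners ℝ E' H'}
  {X' : Type*} [TopologicalSpace X'] [ChartedSpace H' X']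
  {E'' : Type*} [NormedAddCommGroup E''] [NormedSpace ℝ E'']
  {H'' : Type*} [TopologicalSpace H''] {I'' : ModelWithCorners ℝ E'' H''}
  {X'' : Type*} [TopologicalSpace X''] [ChartedSpace H'' X'']

variable (I I') in
/-- `f` is smooth on a whole neighbourhood of `x`. This is stronger than `ContMDiffAt I I' ∞ f x`,
which provides for each finite `n` a neighbourhood, depending on `n`, on which `f` is `C^n`. -/
def SmoothNear (f : X → X') (x : X) : Prop := ∀ᶠ z in 𝓝 x, ContMDiffAt I I' ∞ f z

theorem hasMFDerivAt_comp {g : X' → X''} {f : X → X'} {x : X} {y : X'} {g' : E' →L[ℝ] E''}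
    {f' : E →L[ℝ] E'} (hg : HasMFDerivAt I' I'' g y g') (hf : HasMFDerivAt I I' f x f')
    (h : f x = y) : HasMFDerivAt I I'' (fun z => g (f z)) x (g' ∘L f') := by
  subst h
  exact hg.comp x hf

theorem hasMFDerivAt_prodMk_space {g : X → E'} {h : X → E''} {x : X} {g' : E →L[ℝ] E'}
    {h' : E →L[ℝ] E''} (hg : HasMFDerivAt I 𝓘(ℝ, E') g x g')
    (hh : HasMFDerivAt I 𝓘(ℝ, E'') h x h') :
    HasMFDerivAt I 𝓘(ℝ, E' × E'') (fun z => (g z, h z)) x (g'.prod h') :=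
  ⟨hg.1.prodMk hh.1, hg.2.prodMk hh.2⟩

theorem smoothNear_of_contMDiff {f : X → X'} (hf : ContMDiff I I' ∞ f) (x : X) :
    SmoothNear I I' f x :=
  Eventually.of_forall hf

namespace SmoothNear

variable {f : X → X'} {x : X}

theorem contMDiffAt (hf : SmoothNear I I' f x) : ContMDiffAt I I' ∞ f x := hf.self_of_nhds

theorem continuousAt (hf : SmoothNear I I' f x) : ContinuousAt f x := hf.contMDiffAt.continuousAt

theorem mdifferentiableAt (hf : SmoothNear I I' f x) : MDifferentiableAt I I' f x :=
  hf.contMDiffAt.mdifferentiableAt (by simp)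

theorem hasMFDerivAt (hf : SmoothNear I I' f x) : HasMFDerivAt I I' f x (mfderiv I I' f x) :=
  hf.mdifferentiableAt.hasMFDerivAt

theorem tendsto (hf : SmoothNear I I' f x) {y : X'} (h : f x = y) : Tendsto f (𝓝 x) (𝓝 y) :=
  h ▸ hf.continuousAt

theorem eventually (hf : SmoothNear I I' f x) : ∀ᶠ z in 𝓝 x, SmoothNear I I' f z :=
  eventually_eventually_nhds.2 hf

theorem comp {g : X' → X''} {y : X'} (hg : SmoothNear I' I'' g y) (hf : SmoothNear I I' f x)
    (h : f x = y) : SmoothNear I I'' (fun z => g (f z)) x := by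
  filter_upwards [hf, hf.tendsto h hg] with z hz hgz
  exact ContMDiffAt.comp z hgz hz

theorem prodMk_space {g : X → E'} {h : X → E''} (hg : SmoothNear I 𝓘(ℝ, E') g x)
    (hh : SmoothNear I 𝓘(ℝ, E'') h x) :
    SmoothNear I 𝓘(ℝ, E' × E'') (fun z => (g z, h z)) x := by
  filter_upwards [hg, hh] with z hgz hhz
  exact hgz.prodMk_space hhz

end SmoothNear

theorem smoothNear_clm (A : E →L[ℝ] E') (v : E) : SmoothNear 𝓘(ℝ, E) 𝓘(ℝ, E') A v :=
  smoothNear_of_contMDiff A.contMDiff v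

end SmoothNear

section CenteredCoordinates

variable {E : Type*} [NormedAddCommGroup E] [NormedSpace ℝ E]
  {M : Type*} [TopologicalSpace M] [ChartedSpace E M]

/-- The inverse of the preferred chart at `x`, translated so that it maps `0` to `x`. Its values
outside a neighbourhood of `0` are junk. -/
noncomputable def localParam (x : M) (t : E) : M :=
  (extChartAt 𝓘(ℝ, E) x).symm (t + extChartAt 𝓘(ℝ, E) x x)

/-- The preferred chart at `x`, translated so that it maps `x` to `0`. Its values outside a
neighbourhood of `x` are junk. -/
noncomputable def localCoord (x z : M) : E := extChartAt 𝓘(ℝ, E) x z - extChartAt 𝓘(ℝ, E) x x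

@[simp]
theorem localParam_zero (x : M) : localParam x (0 : E) = x := by
  simp [localParam]

@[simp]
theorem localCoord_self (x : M) : localCoord x x = (0 : E) := sub_self _

theorem eventually_add_mem_target (x : M) :
    ∀ᶠ t in 𝓝 (0 : E), t + extChartAt 𝓘(ℝ, E) x x ∈ (extChartAt 𝓘(ℝ, E) x).target := by
  have hc : ContinuousAt (fun t : E => t + extChartAt 𝓘(ℝ, E) x x) 0 := by fun_prop
  exact hc (by simpa using extChartAt_target_mem_nhds (I := 𝓘(ℝ, E)) x)

theorem eventually_localParam_localCoord (x : M) :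
    ∀ᶠ z in 𝓝 x, localParam x (localCoord x z : E) = z := by
  filter_upwards [extChartAt_source_mem_nhds (I := 𝓘(ℝ, E)) x] with z hz
  simp only [localCoord, localParam, sub_add_cancel, PartialEquiv.left_inv _ hz]

variable [IsManifold 𝓘(ℝ, E) ∞ M]

theorem smoothNear_localParam (x : M) :
    SmoothNear 𝓘(ℝ, E) 𝓘(ℝ, E) (localParam x) (0 : E) := by
  have hadd : ContMDiff 𝓘(ℝ, E) 𝓘(ℝ, E) ∞ (fun t : E => t + extChartAt 𝓘(ℝ, E) x x) :=
    (contDiff_id.add contDiff_const).contMDiff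
  filter_upwards [eventually_add_mem_target x] with t ht
  exact ((contMDiffOn_extChartAt_symm x).contMDiffAt
    ((isOpen_extChartAt_target x).mem_nhds ht)).comp t hadd.contMDiffAt

theorem smoothNear_localCoord (x : M) : SmoothNear 𝓘(ℝ, E) 𝓘(ℝ, E) (localCoord x : M → E) x := by
  have hsub : ContMDiff 𝓘(ℝ, E) 𝓘(ℝ, E) ∞ (fun t : E => t - extChartAt 𝓘(ℝ, E) x x) :=
    (contDiff_id.sub contDiff_const).contMDiff
  filter_upwards [extChartAt_source_mem_nhds (I := 𝓘(ℝ, E)) x] with z hz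
  exact hsub.contMDiffAt.comp z (contMDiffAt_extChartAt' (by simpa using hz))

theorem hasMFDerivAt_localParam (x : M) :
    HasMFDerivAt 𝓘(ℝ, E) 𝓘(ℝ, E) (localParam x) (0 : E) (ContinuousLinearMap.id ℝ E) := by
  refine ⟨(smoothNear_localParam x).continuousAt, ?_⟩
  simp only [mfld_simps]
  refine HasFDerivAt.hasFDerivWithinAt (x := (0 : E))
    (((hasFDerivAt_id (𝕜 := ℝ) (0 : E)).add_const (chartAt E x x)).congr_of_eventuallyEq ?_)
  filter_upwards [eventually_add_mem_target x] with t ht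
  have hright := PartialEquiv.right_inv _ ht
  simp only [localParam, mfld_simps, zero_add] at hright ⊢
  exact hright

theorem hasMFDerivAt_localCoord (x : M) :
    HasMFDerivAt 𝓘(ℝ, E) 𝓘(ℝ, E) (localCoord x : M → E) x (ContinuousLinearMap.id ℝ E) := by
  refine ⟨(smoothNear_localCoord x).continuousAt, ?_⟩
  simp only [mfld_simps]
  refine HasFDerivAt.hasFDerivWithinAt (x := chartAt E x x)
    (((hasFDerivAt_id (𝕜 := ℝ) _).sub_const (chartAt E x x)).congr_of_eventuallyEq ?_)
  filter_upwards [(chartAt E x).open_target.mem_nhds (mem_chart_target E x)] with t ht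
  simp only [localCoord, mfld_simps, (chartAt E x).right_inv ht]
  rfl

end CenteredCoordinates

section InverseFunctionTheorem

variable {E : Type*} [NormedAddCommGroup E] [NormedSpace ℝ E]
  {F : Type*} [NormedAddCommGroup F] [NormedSpace ℝ F]

theorem exists_contDiff_local_inverse [CompleteSpace E] {f : E → F} {a : E} (f' : E ≃L[ℝ] F)
    (hf : ∀ᶠ x in 𝓝 a, ContDiffAt ℝ ∞ f x) (hf' : HasFDerivAt f (f' : E →L[ℝ] F) a) :
    ∃ g : F → E, (∀ᶠ y in 𝓝 (f a), ContDiffAt ℝ ∞ g y) ∧ (∀ᶠ x in 𝓝 a, g (f x) = x) ∧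
      ∀ᶠ y in 𝓝 (f a), f (g y) = y := by
  have hfa : ContDiffAt ℝ ∞ f a := hf.self_of_nhds
  set e := hfa.toOpenPartialHomeomorph f hf' (by simp)
  have hmem : a ∈ e.source := hfa.mem_toOpenPartialHomeomorph_source hf' (by simp)
  have hmem' : f a ∈ e.target := hfa.image_mem_toOpenPartialHomeomorph_target hf' (by simp)
  have hinv : ∀ᶠ x in 𝓝 a, fderiv ℝ f x ∈ Set.range ((↑) : (E ≃L[ℝ] F) → E →L[ℝ] F) := by
    have hcont : ContinuousAt (fderiv ℝ f) a :=
      (hfa.fderiv_right (m := 0) (by simp)).continuousAt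
    exact hcont (by rw [hf'.fderiv]; exact f'.nhds)
  have hsymm : Tendsto e.symm (𝓝 (f a)) (𝓝 a) := by
    simpa only [show e.symm (f a) = a from e.left_inv hmem] using
      (e.continuousAt_symm hmem').tendsto
  refine ⟨e.symm, ?_, e.eventually_left_inverse hmem, e.eventually_right_inverse hmem'⟩
  filter_upwards [e.open_target.mem_nhds hmem', hsymm.eventually (hf.and hinv)]
    with y hy ⟨hfy, A, hA⟩
  refine e.contDiffAt_symm hy (f₀' := A) ?_ hfy
  rw [hA]
  exact (hfy.differentiableAt (by simp)).hasFDerivAt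

variable {M : Type*} [TopologicalSpace M] [ChartedSpace E M] [IsManifold 𝓘(ℝ, E) ∞ M]
  {N : Type*} [TopologicalSpace N] [ChartedSpace F N] [IsManifold 𝓘(ℝ, F) ∞ N]

theorem exists_smooth_local_inverse [CompleteSpace E] {f : M → N} {x : M} (f' : E ≃L[ℝ] F)
    (hf : SmoothNear 𝓘(ℝ, E) 𝓘(ℝ, F) f x)
    (hf' : HasMFDerivAt 𝓘(ℝ, E) 𝓘(ℝ, F) f x (f' : E →L[ℝ] F)) :
    ∃ g : N → M, SmoothNear 𝓘(ℝ, F) 𝓘(ℝ, E) g (f x) ∧ (∀ᶠ z in 𝓝 x, g (f z) = z) ∧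
      ∀ᶠ w in 𝓝 (f x), f (g w) = w := by
  set φ : E → F := fun t => localCoord (f x) (f (localParam x t)) with hφ
  have hfp : SmoothNear 𝓘(ℝ, E) 𝓘(ℝ, F) (fun t : E => f (localParam x t)) 0 :=
    hf.comp (smoothNear_localParam x) (localParam_zero x)
  have hφ0 : φ 0 = 0 := by simp [hφ]
  have hφs : SmoothNear 𝓘(ℝ, E) 𝓘(ℝ, F) φ 0 :=
    (smoothNear_localCoord (E := F) (f x)).comp hfp (by simp)
  have hφd : HasFDerivAt φ (f' : E →L[ℝ] F) 0 := by
    have hφ' := hasMFDerivAt_comp (hasMFDerivAt_localCoord (E := F) (f x))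
      (hasMFDerivAt_comp hf' (hasMFDerivAt_localParam x) (localParam_zero x)) (by simp)
    exact hasMFDerivAt_iff_hasFDerivAt.1 hφ'
  obtain ⟨ψ, hψs, hψφ, hφψ⟩ := exists_contDiff_local_inverse f'
    (hφs.mono fun _ h => h.contDiffAt) hφd
  rw [hφ0] at hψs hφψ
  have hψ0 : ψ 0 = 0 := by simpa only [hφ0] using hψφ.self_of_nhds
  have hψs' : SmoothNear 𝓘(ℝ, F) 𝓘(ℝ, E) (fun w => ψ (localCoord (f x) w)) (f x) :=
    SmoothNear.comp (hψs.mono fun _ h => h.contMDiffAt) (smoothNear_localCoord (E := F) (f x))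
      (localCoord_self _)
  have hψc : ψ (localCoord (f x) (f x)) = 0 := by rw [localCoord_self, hψ0]
  have hgs := (smoothNear_localParam x).comp hψs' hψc
  refine ⟨fun w => localParam x (ψ (localCoord (f x) w)), hgs, ?_, ?_⟩
  · have hcoord := (smoothNear_localCoord (E := E) x).tendsto (localCoord_self x)
    filter_upwards [hcoord.eventually hψφ, eventually_localParam_localCoord (E := E) x]
      with z hz hpc
    simp only [hφ, hpc] at hz
    rw [hz, hpc]
  · have hcoord := (smoothNear_localCoord (E := F) (f x)).tendsto (localCoord_self (f x))
    have hfg := (hf.comp hgs (by rw [hψc, localParam_zero])).tendsto (y := f x)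
      (by rw [hψc, localParam_zero])
    filter_upwards [hcoord.eventually hφψ, eventually_localParam_localCoord (E := F) (f x),
      hfg.eventually (eventually_localParam_localCoord (E := F) (f x))]
      with w hw hpc hpc'
    exact hpc'.symm.trans ((congrArg _ hw).trans hpc)

end InverseFunctionTheorem

/-! ### The constant rank theorem -/

section LocalInverses

variable {E : Type*} [NormedAddCommGroup E] [NormedSpace ℝ E]
  {M : Type*} [TopologicalSpace M] [ChartedSpace E M] [IsManifold 𝓘(ℝ, E) ∞ M]
  {F : Type*} [NormedAddCommGroup F] [NormedSpace ℝ F]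
  {N : Type*} [TopologicalSpace N] [ChartedSpace F N] [IsManifold 𝓘(ℝ, F) ∞ N]

theorem exists_smooth_local_section [FiniteDimensional ℝ F] {f : M → N} {x : M}
    (hf : SmoothNear 𝓘(ℝ, E) 𝓘(ℝ, F) f x)
    (hsurj : Surjective (mfderiv 𝓘(ℝ, E) 𝓘(ℝ, F) f x)) :
    ∃ σ : N → M, σ (f x) = x ∧ SmoothNear 𝓘(ℝ, F) 𝓘(ℝ, E) σ (f x) ∧
      ∀ᶠ w in 𝓝 (f x), f (σ w) = w := by
  set f' : E →L[ℝ] F := mfderiv 𝓘(ℝ, E) 𝓘(ℝ, F) f x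
  obtain ⟨B, hB⟩ := f'.exists_rightInverse_of_surjective (LinearMap.range_eq_top.2 hsurj)
  have hs : SmoothNear 𝓘(ℝ, F) 𝓘(ℝ, E) (fun w => localParam x (B w)) 0 :=
    (smoothNear_localParam x).comp (smoothNear_clm B 0) (map_zero B)
  have hs0 : localParam x (B 0) = x := by rw [map_zero, localParam_zero]
  have hd : HasMFDerivAt 𝓘(ℝ, F) 𝓘(ℝ, F) (fun w => f (localParam x (B w))) 0
      ((ContinuousLinearEquiv.refl ℝ F : F ≃L[ℝ] F) : F →L[ℝ] F) := by
    have hd' := hasMFDerivAt_comp hf.hasMFDerivAt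
      (hasMFDerivAt_comp (hasMFDerivAt_localParam x) B.hasMFDerivAt (map_zero B)) hs0
    exact hd'.congr_mfderiv hB
  obtain ⟨g, hgs, hgl, hgr⟩ := exists_smooth_local_inverse _ (hf.comp hs hs0) hd
  have hg0 := hgl.self_of_nhds
  rw [hs0] at hgs hgr hg0
  exact ⟨fun w => localParam x (B (g w)), by simp only [hg0, hs0], hs.comp hgs hg0, hgr⟩

theorem exists_smooth_local_retraction [FiniteDimensional ℝ F] {f : M → N} {x : M}
    (hf : SmoothNear 𝓘(ℝ, E) 𝓘(ℝ, F) f x)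
    (hinj : Injective (mfderiv 𝓘(ℝ, E) 𝓘(ℝ, F) f x)) :
    ∃ r : N → M, SmoothNear 𝓘(ℝ, F) 𝓘(ℝ, E) r (f x) ∧ ∀ᶠ z in 𝓝 x, r (f z) = z := by
  set f' : E →L[ℝ] F := mfderiv 𝓘(ℝ, E) 𝓘(ℝ, F) f x
  have : FiniteDimensional ℝ E := FiniteDimensional.of_injective f'.toLinearMap hinj
  obtain ⟨A, hA⟩ :=
    ContinuousLinearMap.HasLeftInverse.of_injective_of_finiteDimensional (f := f') hinj
  have hs : SmoothNear 𝓘(ℝ, F) 𝓘(ℝ, E) (fun w => A (localCoord (f x) w)) (f x) :=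
    (smoothNear_clm A _).comp (smoothNear_localCoord (f x)) rfl
  have hd : HasMFDerivAt 𝓘(ℝ, E) 𝓘(ℝ, E) (fun z => A (localCoord (f x) (f z))) x
      ((ContinuousLinearEquiv.refl ℝ E : E ≃L[ℝ] E) : E →L[ℝ] E) := by
    have hd' := hasMFDerivAt_comp (hasMFDerivAt_comp A.hasMFDerivAt
      (hasMFDerivAt_localCoord (E := F) (f x)) rfl) hf.hasMFDerivAt rfl
    exact hd'.congr_mfderiv (ContinuousLinearMap.ext hA)
  obtain ⟨g, hgs, hgl, -⟩ := exists_smooth_local_inverse _ (hs.comp hf rfl) hd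
  exact ⟨fun w => g (A (localCoord (f x) w)), hgs.comp hs rfl, hgl⟩

end LocalInverses

section ConstantRank

theorem eventually_eq_of_fderiv_eq_zero {E F : Type*} [NormedAddCommGroup E] [NormedSpace ℝ E]
    [NormedAddCommGroup F] [NormedSpace ℝ F] {f : E → F} {a : E}
    (hf : ∀ᶠ x in 𝓝 a, HasFDerivAt f (0 : E →L[ℝ] F) x) : ∀ᶠ x in 𝓝 a, f x = f a := by
  obtain ⟨ε, hε, hball⟩ := Metric.eventually_nhds_iff_ball.1 hf
  filter_upwards [Metric.ball_mem_nhds a hε] with x hx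
  exact Metric.isOpen_ball.is_const_of_fderiv_eq_zero (convex_ball a ε).isPreconnected
    (fun z hz => (hball z hz).differentiableAt.differentiableWithinAt)
    (fun z hz => (hball z hz).fderiv) hx (Metric.mem_ball_self hε)

theorem ker_comp_le_ker_of_surjective {K V W U : Type*} [DivisionRing K] [AddCommGroup V]
    [Module K V] [FiniteDimensional K V] [AddCommGroup W] [Module K W] [AddCommGroup U]
    [Module K U] {T : V →ₗ[K] W} {P : W →ₗ[K] U} (hsurj : Surjective (P ∘ₗ T))
    (hdim : finrank K V ≤ finrank K U + finrank K T.ker) : (P ∘ₗ T).ker ≤ T.ker := by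
  have hle : T.ker ≤ (P ∘ₗ T).ker := LinearMap.ker_le_ker_comp T P
  have hsum := LinearMap.finrank_range_add_finrank_ker (P ∘ₗ T)
  rw [LinearMap.range_eq_top.2 hsurj, finrank_top] at hsum
  exact (Submodule.eq_of_le_of_finrank_le hle (by lia)).ge

variable {E : Type*} [NormedAddCommGroup E] [NormedSpace ℝ E]
  {M : Type*} [TopologicalSpace M] [ChartedSpace E M]
  {F : Type*} [NormedAddCommGroup F] [NormedSpace ℝ F]

theorem surjective_of_local_rightInverse {N : Type*} [TopologicalSpace N] [ChartedSpace F N]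
    {f : M → N} {g : N → M} {w : N} {x : M} {f' : E →L[ℝ] F}
    (hf : HasMFDerivAt 𝓘(ℝ, E) 𝓘(ℝ, F) f x f')
    (hg : MDifferentiableAt 𝓘(ℝ, F) 𝓘(ℝ, E) g w) (hgw : g w = x)
    (hfg : ∀ᶠ u in 𝓝 w, f (g u) = u) : Surjective f' := by
  set g' : F →L[ℝ] E := mfderiv 𝓘(ℝ, F) 𝓘(ℝ, E) g w
  have hcomp := hasMFDerivAt_comp hf hg.hasMFDerivAt hgw
  have hid : HasMFDerivAt 𝓘(ℝ, F) 𝓘(ℝ, F) (fun u => f (g u)) w (ContinuousLinearMap.id ℝ F) :=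
    (hasMFDerivAt_id w).congr_of_eventuallyEq hfg
  exact fun v => ⟨g' v, DFunLike.congr_fun (hasMFDerivAt_unique hcomp hid) v⟩

/-- The kernel of the derivative of `f` at `x`, as a subspace of the model space. -/
noncomputable def mfderivKer {E : Type*} [NormedAddCommGroup E] [NormedSpace ℝ E]
    {H : Type*} [TopologicalSpace H] (I : ModelWithCorners ℝ E H)
    {M : Type*} [TopologicalSpace M] [ChartedSpace H M]
    {E' : Type*} [NormedAddCommGroup E'] [NormedSpace ℝ E']
    {H' : Type*} [TopologicalSpace H'] (I' : ModelWithCorners ℝ E' H')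
    {M' : Type*} [TopologicalSpace M'] [ChartedSpace H' M'] (f : M → M') (x : M) :
    Submodule ℝ E :=
  (mfderiv I I' f x : E →L[ℝ] E').ker

theorem eventually_eq_of_ker_comp_le {U W : Type*} [NormedAddCommGroup U] [NormedSpace ℝ U]
    [NormedAddCommGroup W] [NormedSpace ℝ W] {f : M → F} {P : F →L[ℝ] U} {κ : W → M} {t₀ : W}
    {u : U} (hκ : SmoothNear 𝓘(ℝ, W) 𝓘(ℝ, E) κ t₀)
    (hf : ∀ᶠ t in 𝓝 t₀, ContMDiffAt 𝓘(ℝ, E) 𝓘(ℝ, F) ∞ f (κ t))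
    (hker : ∀ᶠ t in 𝓝 t₀, (P ∘L (mfderiv 𝓘(ℝ, E) 𝓘(ℝ, F) f (κ t) : E →L[ℝ] F)).ker ≤
      mfderivKer 𝓘(ℝ, E) 𝓘(ℝ, F) f (κ t))
    (hP : ∀ᶠ t in 𝓝 t₀, P (f (κ t)) = u) : ∀ᶠ t in 𝓝 t₀, f (κ t) = f (κ t₀) := by
  refine eventually_eq_of_fderiv_eq_zero (f := fun t => f (κ t)) ?_
  filter_upwards [hκ, hf, hker, hP.eventually_nhds] with t hκt hft hkert hPt
  set κ' : W →L[ℝ] E := mfderiv 𝓘(ℝ, W) 𝓘(ℝ, E) κ t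
  have hfκ := hasMFDerivAt_comp (hft.mdifferentiableAt (by simp)).hasMFDerivAt
    (hκt.mdifferentiableAt (by simp)).hasMFDerivAt rfl
  have hPfκ := hasMFDerivAt_unique (hasMFDerivAt_comp P.hasMFDerivAt hfκ rfl)
    ((hasMFDerivAt_const u t).congr_of_eventuallyEq hPt)
  refine hasMFDerivAt_iff_hasFDerivAt.1 (hfκ.congr_mfderiv (ContinuousLinearMap.ext fun v => ?_))
  exact hkert (show κ' v ∈ _ from DFunLike.congr_fun hPfκ v)

/-- A smooth chart, modelled on `K` and centered at `x`, of the fibre of `f` through `x`. The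
coordinate `coord` is defined on a neighbourhood of `x` in the ambient manifold. -/
structure FibreChart {Y : Type*} (f : M → Y) (x : M) (K : Submodule ℝ E) where
  param : K → M
  coord : M → K
  param_zero : param 0 = x
  smoothNear_param : SmoothNear 𝓘(ℝ, K) 𝓘(ℝ, E) param 0
  smoothNear_coord : SmoothNear 𝓘(ℝ, E) 𝓘(ℝ, K) coord x
  hasMFDerivAt_param : HasMFDerivAt 𝓘(ℝ, K) 𝓘(ℝ, E) param 0 K.subtypeL
  apply_param : ∀ᶠ t in 𝓝 0, f (param t) = f x
  coord_param : ∀ᶠ t in 𝓝 0, coord (param t) = t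
  param_coord : ∀ᶠ z in 𝓝 x, f z = f x → param (coord z) = z

theorem FibreChart.coord_self {Y : Type*} {f : M → Y} {x : M} {K : Submodule ℝ E}
    (κ : FibreChart f x K) : κ.coord x = 0 := by
  simpa only [κ.param_zero] using κ.coord_param.self_of_nhds

theorem exists_equiv_range_prod_ker [FiniteDimensional ℝ E] (T : E →L[ℝ] F) :
    ∃ (P : F →L[ℝ] T.range) (A : E →L[ℝ] T.ker) (e : E ≃L[ℝ] T.range × T.ker),
      (∀ v, e v = (P (T v), A v)) ∧ ∀ t : T.ker, A t = t := by
  obtain ⟨P, hP⟩ := Submodule.ClosedComplemented.of_finiteDimensional T.range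
  obtain ⟨A, hA⟩ := Submodule.ClosedComplemented.of_finiteDimensional T.ker
  have hPT : P ∘L T = T.rangeRestrict :=
    ContinuousLinearMap.ext fun v => hP (T.rangeRestrict v)
  have hcompl : IsCompl (P ∘L T).ker A.ker := by
    have hker : (P ∘L T).ker = T.ker := by
      rw [hPT]
      exact LinearMap.ker_rangeRestrict T.toLinearMap
    rw [hker]
    exact LinearMap.isCompl_of_proj hA
  have hrange : (P ∘L T).range = ⊤ := by
    rw [hPT]
    exact LinearMap.range_rangeRestrict T.toLinearMap
  have hArange : A.range = ⊤ := LinearMap.range_eq_top.2 fun t => ⟨t, hA t⟩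
  exact ⟨P, A, (P ∘L T).equivProdOfSurjectiveOfIsCompl A hrange hArange hcompl,
    fun _ => rfl, hA⟩

variable [FiniteDimensional ℝ E]

theorem ker_comp_mfderiv_le {U W : Type*} [NormedAddCommGroup U] [NormedSpace ℝ U]
    [NormedAddCommGroup W] [NormedSpace ℝ W] {f : M → F} {P : F →L[ℝ] U} {c : M → W}
    {Ψ : U × W → M} {z : M} (hf : MDifferentiableAt 𝓘(ℝ, E) 𝓘(ℝ, F) f z)
    (hc : MDifferentiableAt 𝓘(ℝ, E) 𝓘(ℝ, W) c z)
    (hΨ : MDifferentiableAt 𝓘(ℝ, U × W) 𝓘(ℝ, E) Ψ (P (f z), c z)) (hΨz : Ψ (P (f z), c z) = z)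
    (hΦΨ : ∀ᶠ w in 𝓝 (P (f z), c z), (P (f (Ψ w)), c (Ψ w)) = w)
    (hdim : finrank ℝ E ≤ finrank ℝ U + finrank ℝ (mfderivKer 𝓘(ℝ, E) 𝓘(ℝ, F) f z)) :
    (P ∘L (mfderiv 𝓘(ℝ, E) 𝓘(ℝ, F) f z : E →L[ℝ] F)).ker ≤ mfderivKer 𝓘(ℝ, E) 𝓘(ℝ, F) f z := by
  have hsurj := surjective_of_local_rightInverse (hasMFDerivAt_prodMk_space
    (hasMFDerivAt_comp P.hasMFDerivAt hf.hasMFDerivAt rfl) hc.hasMFDerivAt) hΨ hΨz hΦΨ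
  exact ker_comp_le_ker_of_surjective (P := P.toLinearMap)
    (fun u => (hsurj (u, 0)).imp fun v hv => congrArg Prod.fst hv) hdim

variable [IsManifold 𝓘(ℝ, E) ∞ M]

theorem exists_rank_coordinates {f : M → F} {x : M} {f' : E →L[ℝ] F}
    (hf : SmoothNear 𝓘(ℝ, E) 𝓘(ℝ, F) f x) (hf' : HasMFDerivAt 𝓘(ℝ, E) 𝓘(ℝ, F) f x f') :
    ∃ (P : F →L[ℝ] f'.range) (c : M → f'.ker) (Ψ : f'.range × f'.ker → M),
      SmoothNear 𝓘(ℝ, E) 𝓘(ℝ, f'.ker) c x ∧ c x = 0 ∧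
      SmoothNear 𝓘(ℝ, f'.range × f'.ker) 𝓘(ℝ, E) Ψ (P (f x), 0) ∧
      HasMFDerivAt 𝓘(ℝ, f'.ker) 𝓘(ℝ, E) (fun t => Ψ (P (f x), t)) 0 f'.ker.subtypeL ∧
      (∀ᶠ z in 𝓝 x, Ψ (P (f z), c z) = z) ∧
      ∀ᶠ w in 𝓝 (P (f x), (0 : f'.ker)), (P (f (Ψ w)), c (Ψ w)) = w := by
  obtain ⟨P, A, e, he, hA⟩ := exists_equiv_range_prod_ker f'
  have hc : SmoothNear 𝓘(ℝ, E) 𝓘(ℝ, f'.ker) (fun z => A (localCoord x z)) x :=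
    (smoothNear_clm A _).comp (smoothNear_localCoord x) rfl
  have hΦ := ((smoothNear_clm P _).comp hf rfl).prodMk_space hc
  have hΦ' : HasMFDerivAt 𝓘(ℝ, E) 𝓘(ℝ, f'.range × f'.ker)
      (fun z => (P (f z), A (localCoord x z))) x (e : E →L[ℝ] f'.range × f'.ker) :=
    (hasMFDerivAt_prodMk_space (hasMFDerivAt_comp P.hasMFDerivAt hf' rfl)
      (hasMFDerivAt_comp A.hasMFDerivAt (hasMFDerivAt_localCoord (E := E) x) rfl)).congr_mfderiv
      (ContinuousLinearMap.ext fun v => (he v).symm)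
  obtain ⟨Ψ, hΨ, hΨΦ, hΦΨ⟩ := exists_smooth_local_inverse e hΦ hΦ'
  have hΨx := hΨΦ.self_of_nhds
  rw [localCoord_self, map_zero] at hΨ hΦΨ hΨx
  refine ⟨P, fun z => A (localCoord x z), Ψ, hc, by simp, hΨ, ?_, hΨΦ, hΦΨ⟩
  have hin : SmoothNear 𝓘(ℝ, f'.ker) 𝓘(ℝ, f'.range × f'.ker)
      (fun t : f'.ker => (P (f x), t)) 0 :=
    smoothNear_of_contMDiff (contDiff_const.prodMk contDiff_id).contMDiff 0
  have hin' : HasMFDerivAt 𝓘(ℝ, f'.ker) 𝓘(ℝ, f'.range × f'.ker)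
      (fun t : f'.ker => (P (f x), t)) (0 : f'.ker)
      ((0 : f'.ker →L[ℝ] f'.range).prod (ContinuousLinearMap.id ℝ f'.ker)) :=
    hasMFDerivAt_prodMk_space (hasMFDerivAt_const _ _) (hasMFDerivAt_id _)
  have hκ := (hΨ.comp hin rfl).hasMFDerivAt
  have hΦκ := hasMFDerivAt_unique (hasMFDerivAt_comp hΦ' hκ hΨx)
    (hin'.congr_of_eventuallyEq ((hin.tendsto rfl).eventually hΦΨ))
  have hsubtype : ∀ t : f'.ker, e t = (0, t) := fun t => by
    rw [he, hA, show f' t = 0 from t.2, map_zero]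
  exact hκ.congr_mfderiv (ContinuousLinearMap.ext fun t => e.injective
    ((DFunLike.congr_fun hΦκ t).trans (hsubtype t).symm))

theorem nonempty_fibreChart_of_hasMFDerivAt {f : M → F} {x : M} {f' : E →L[ℝ] F}
    (hf : SmoothNear 𝓘(ℝ, E) 𝓘(ℝ, F) f x) (hf' : HasMFDerivAt 𝓘(ℝ, E) 𝓘(ℝ, F) f x f')
    (hrank : ∀ᶠ z in 𝓝 x, finrank ℝ f'.ker ≤ finrank ℝ (mfderivKer 𝓘(ℝ, E) 𝓘(ℝ, F) f z)) :
    Nonempty (FibreChart f x f'.ker) := by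
  obtain ⟨P, c, Ψ, hc, hcx, hΨ, hΨ', hΨΦ, hΦΨ⟩ := exists_rank_coordinates hf hf'
  have hΦ : Tendsto (fun z => (P (f z), c z)) (𝓝 x) (𝓝 (P (f x), 0)) :=
    (((smoothNear_clm P _).comp hf rfl).prodMk_space hc).tendsto (by rw [hcx])
  have hker : ∀ᶠ z in 𝓝 x, (P ∘L (mfderiv 𝓘(ℝ, E) 𝓘(ℝ, F) f z : E →L[ℝ] F)).ker ≤
      mfderivKer 𝓘(ℝ, E) 𝓘(ℝ, F) f z := by
    filter_upwards [hrank, hf, hc, hΨΦ, hΦ hΨ, hΦ hΦΨ.eventually_nhds]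
      with z hz hfz hcz hΨΦz hΨz hΦΨz
    refine ker_comp_mfderiv_le (hfz.mdifferentiableAt (by simp)) (hcz.mdifferentiableAt (by simp))
      (hΨz.mdifferentiableAt (by simp)) hΨΦz hΦΨz ?_
    have hsum := LinearMap.finrank_range_add_finrank_ker f'.toLinearMap
    lia
  have hκ : SmoothNear 𝓘(ℝ, f'.ker) 𝓘(ℝ, E) (fun t : f'.ker => Ψ (P (f x), t)) 0 :=
    hΨ.comp (smoothNear_of_contMDiff (contDiff_const.prodMk contDiff_id).contMDiff 0) rfl
  have hκ0 : Ψ (P (f x), 0) = x := by simpa only [hcx] using hΨΦ.self_of_nhds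
  have hΦκ : ∀ᶠ t : f'.ker in 𝓝 0, (P (f (Ψ (P (f x), t))), c (Ψ (P (f x), t))) = (P (f x), t) :=
    (show ContinuousAt (fun t : f'.ker => (P (f x), t)) 0 by fun_prop).eventually hΦΨ
  refine ⟨⟨fun t => Ψ (P (f x), t), c, hκ0, hκ, hc, hΨ', ?_,
    hΦκ.mono fun t ht => congrArg Prod.snd ht, hΨΦ.mono fun z hz hfz => by rwa [hfz] at hz⟩⟩
  have hconst := eventually_eq_of_ker_comp_le hκ (hκ.tendsto hκ0 hf) (hκ.tendsto hκ0 hker)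
    (hΦκ.mono fun t ht => congrArg Prod.fst ht)
  exact hconst.mono fun t ht => ht.trans (congrArg f hκ0)

variable {N : Type*} [TopologicalSpace N] [ChartedSpace F N] [IsManifold 𝓘(ℝ, F) ∞ N]

/-- The constant rank theorem: the dimension of the kernel is upper semicontinuous, so that `hrank`
makes it locally constant. -/
theorem nonempty_fibreChart {f : M → N} {x : M} (hf : SmoothNear 𝓘(ℝ, E) 𝓘(ℝ, F) f x)
    (hrank : ∀ᶠ z in 𝓝 x, finrank ℝ (mfderivKer 𝓘(ℝ, E) 𝓘(ℝ, F) f x) ≤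
      finrank ℝ (mfderivKer 𝓘(ℝ, E) 𝓘(ℝ, F) f z)) :
    Nonempty (FibreChart f x (mfderivKer 𝓘(ℝ, E) 𝓘(ℝ, F) f x)) := by
  have hcoord := smoothNear_localCoord (E := F) (f x)
  have hparam := hf.tendsto rfl (eventually_localParam_localCoord (E := F) (f x))
  have hderiv : HasMFDerivAt 𝓘(ℝ, E) 𝓘(ℝ, F) (fun z => (localCoord (f x) (f z) : F)) x
      (mfderiv 𝓘(ℝ, E) 𝓘(ℝ, F) f x : E →L[ℝ] F) :=
    hasMFDerivAt_comp (hasMFDerivAt_localCoord (E := F) (f x)) hf.hasMFDerivAt rfl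
  have hrank' : ∀ᶠ z in 𝓝 x, finrank ℝ (mfderivKer 𝓘(ℝ, E) 𝓘(ℝ, F) f x) ≤
      finrank ℝ (mfderivKer 𝓘(ℝ, E) 𝓘(ℝ, F) (fun z => (localCoord (f x) (f z) : F)) z) := by
    filter_upwards [hrank, hf, hf.tendsto rfl hcoord] with z hz hfz hcz
    set A : F →L[ℝ] F := mfderiv 𝓘(ℝ, F) 𝓘(ℝ, F) (localCoord (E := F) (f x)) (f z)
    have hcomp := hasMFDerivAt_comp (hcz.mdifferentiableAt (by simp)).hasMFDerivAt
      (hfz.mdifferentiableAt (by simp)).hasMFDerivAt rfl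
    refine hz.trans (Submodule.finrank_mono fun v hv => ?_)
    rw [mfderivKer, hcomp.mfderiv]
    exact (congrArg A hv).trans (map_zero A)
  obtain ⟨κ⟩ : Nonempty (FibreChart (fun z => (localCoord (f x) (f z) : F)) x
      (mfderivKer 𝓘(ℝ, E) 𝓘(ℝ, F) f x)) :=
    nonempty_fibreChart_of_hasMFDerivAt (hcoord.comp hf rfl) hderiv hrank'
  refine ⟨⟨κ.param, κ.coord, κ.param_zero, κ.smoothNear_param, κ.smoothNear_coord,
    κ.hasMFDerivAt_param, ?_, κ.coord_param, ?_⟩⟩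
  · filter_upwards [κ.apply_param, κ.smoothNear_param.tendsto κ.param_zero hparam]
      with t ht hparamt
    rw [← hparamt, ht, localCoord_self, localParam_zero]
  · exact κ.param_coord.mono fun z hz hfz => hz (by rw [hfz])

end ConstantRank

/-! ### Equivariant maps and the dressing action -/

section EquivariantMaps

variable {E : Type*} [NormedAddCommGroup E] [NormedSpace ℝ E]
  {X : Type*} [TopologicalSpace X] [ChartedSpace E X]
  {F : Type*} [NormedAddCommGroup F] [NormedSpace ℝ F]
  {Y : Type*} [TopologicalSpace Y] [ChartedSpace F Y]
  {G D : Type*} [Group G] [Group D] [MulAction G X] [MulAction D Y]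

theorem exists_equiv_hasMFDerivAt_smul
    (hG : ∀ g : G, ContMDiff 𝓘(ℝ, E) 𝓘(ℝ, E) ∞ (fun x : X => g • x)) (g : G) (x : X) :
    ∃ A : E ≃L[ℝ] E, HasMFDerivAt 𝓘(ℝ, E) 𝓘(ℝ, E) (fun x : X => g • x) x (A : E →L[ℝ] E) := by
  let Φ : X ≃ₘ^∞⟮𝓘(ℝ, E), 𝓘(ℝ, E)⟯ X := ⟨MulAction.toPerm g, hG g, hG g⁻¹⟩
  exact ⟨Φ.mfderivToContinuousLinearEquiv (by simp) x,
    ((hG g).mdifferentiable (by simp) x).hasMFDerivAt⟩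

variable {φ : G →* D} {f : X → Y}

theorem exists_equiv_mfderiv_smul
    (hG : ∀ g : G, ContMDiff 𝓘(ℝ, E) 𝓘(ℝ, E) ∞ (fun x : X => g • x))
    (hD : ∀ d : D, ContMDiff 𝓘(ℝ, F) 𝓘(ℝ, F) ∞ (fun y : Y => d • y))
    (hequiv : ∀ g x, f (g • x) = φ g • f x) {g : G} {x : X} {f' f'' : E →L[ℝ] F}
    (hf' : HasMFDerivAt 𝓘(ℝ, E) 𝓘(ℝ, F) f x f')
    (hf'' : HasMFDerivAt 𝓘(ℝ, E) 𝓘(ℝ, F) f (g • x) f'') :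
    ∃ (A : E ≃L[ℝ] E) (B : F ≃L[ℝ] F), ∀ v, f'' (A v) = B (f' v) := by
  obtain ⟨A, hA⟩ := exists_equiv_hasMFDerivAt_smul hG g x
  obtain ⟨B, hB⟩ := exists_equiv_hasMFDerivAt_smul hD (φ g) (f x)
  have hBf : HasMFDerivAt 𝓘(ℝ, E) 𝓘(ℝ, F) (fun z => f (g • z)) x ((B : F →L[ℝ] F) ∘L f') :=
    (hasMFDerivAt_comp hB hf' rfl).congr_of_eventuallyEq (.of_forall (hequiv g))
  exact ⟨A, B, DFunLike.congr_fun (hasMFDerivAt_unique (hasMFDerivAt_comp hf'' hA rfl) hBf)⟩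

theorem surjective_mfderiv_smul
    (hG : ∀ g : G, ContMDiff 𝓘(ℝ, E) 𝓘(ℝ, E) ∞ (fun x : X => g • x))
    (hD : ∀ d : D, ContMDiff 𝓘(ℝ, F) 𝓘(ℝ, F) ∞ (fun y : Y => d • y))
    (hequiv : ∀ g x, f (g • x) = φ g • f x) (hf : MDifferentiable 𝓘(ℝ, E) 𝓘(ℝ, F) f)
    (g : G) {x : X} (hx : Surjective (mfderiv 𝓘(ℝ, E) 𝓘(ℝ, F) f x)) :
    Surjective (mfderiv 𝓘(ℝ, E) 𝓘(ℝ, F) f (g • x)) := by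
  obtain ⟨A, B, h⟩ :=
    exists_equiv_mfderiv_smul hG hD hequiv (hf x).hasMFDerivAt (hf (g • x)).hasMFDerivAt
  intro w
  obtain ⟨v, hv⟩ := hx (B.symm w)
  exact ⟨A v, (h v).trans ((congrArg B hv).trans (B.apply_symm_apply w))⟩

theorem finrank_ker_eq_of_intertwining {f' f'' : E →L[ℝ] F} {A : E ≃L[ℝ] E} {B : F ≃L[ℝ] F}
    (h : ∀ v, f'' (A v) = B (f' v)) : finrank ℝ f'.ker = finrank ℝ f''.ker := by
  have hker : f'.ker.map A.toLinearEquiv.toLinearMap = f''.ker := by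
    rw [Submodule.map_equiv_eq_comap_symm]
    ext w
    obtain ⟨v, rfl⟩ := A.surjective w
    simp [h]
  rw [← hker, LinearEquiv.finrank_map_eq]

theorem finrank_mfderivKer_smul
    (hG : ∀ g : G, ContMDiff 𝓘(ℝ, E) 𝓘(ℝ, E) ∞ (fun x : X => g • x))
    (hD : ∀ d : D, ContMDiff 𝓘(ℝ, F) 𝓘(ℝ, F) ∞ (fun y : Y => d • y))
    (hequiv : ∀ g x, f (g • x) = φ g • f x) (hf : MDifferentiable 𝓘(ℝ, E) 𝓘(ℝ, F) f)
    (g : G) (x : X) : finrank ℝ (mfderivKer 𝓘(ℝ, E) 𝓘(ℝ, F) f (g • x)) =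
      finrank ℝ (mfderivKer 𝓘(ℝ, E) 𝓘(ℝ, F) f x) := by
  obtain ⟨A, B, h⟩ :=
    exists_equiv_mfderiv_smul hG hD hequiv (hf x).hasMFDerivAt (hf (g • x)).hasMFDerivAt
  exact (finrank_ker_eq_of_intertwining h).symm

end EquivariantMaps

section OrbitMaps

variable {E : Type*} [NormedAddCommGroup E] [NormedSpace ℝ E] [FiniteDimensional ℝ E]
  {G : Type*} [TopologicalSpace G] [ChartedSpace E G] [Group G] [LieGroup 𝓘(ℝ, E) ∞ G]
  {F : Type*} [NormedAddCommGroup F] [NormedSpace ℝ F]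
  {Y : Type*} [TopologicalSpace Y] [ChartedSpace F Y] [IsManifold 𝓘(ℝ, F) ∞ Y]
  {D : Type*} [Group D] [MulAction D Y] {φ : G →* D} {y : Y}

theorem nonempty_isotropyChart
    (hD : ∀ d : D, ContMDiff 𝓘(ℝ, F) 𝓘(ℝ, F) ∞ (fun z : Y => d • z))
    (hy : ContMDiff 𝓘(ℝ, E) 𝓘(ℝ, F) ∞ (fun g : G => φ g • y)) :
    Nonempty (FibreChart (fun g : G => φ g • y) 1
      (mfderivKer 𝓘(ℝ, E) 𝓘(ℝ, F) (fun g : G => φ g • y) 1)) := by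
  have : IsManifold 𝓘(ℝ, E) ∞ G := LieGroup.toContMDiffMul.toIsManifold
  refine nonempty_fibreChart (smoothNear_of_contMDiff hy 1) (.of_forall fun g => ?_)
  have h := finrank_mfderivKer_smul (X := G) (φ := φ) (fun _ => contMDiff_mul_left) hD
    (fun g h => by rw [smul_eq_mul, map_mul, mul_smul]) (hy.mdifferentiable (by simp)) g 1
  rw [smul_eq_mul, mul_one] at h
  exact h.ge

theorem injective_mfderiv_of_trivial_isotropy
    (hD : ∀ d : D, ContMDiff 𝓘(ℝ, F) 𝓘(ℝ, F) ∞ (fun z : Y => d • z))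
    (hy : ContMDiff 𝓘(ℝ, E) 𝓘(ℝ, F) ∞ (fun g : G => φ g • y)) (hfree : ∀ g, φ g • y = y → g = 1) :
    Injective (mfderiv 𝓘(ℝ, E) 𝓘(ℝ, F) (fun g : G => φ g • y) 1) := by
  obtain ⟨κ⟩ := nonempty_isotropyChart hD hy
  have hconst : ∀ᶠ t in 𝓝 0, κ.param t = 1 := by
    filter_upwards [κ.apply_param] with t ht
    exact hfree _ (ht.trans (by rw [map_one, one_smul]))
  have hzero := hasMFDerivAt_unique κ.hasMFDerivAt_param
    ((hasMFDerivAt_const (1 : G) (0 : mfderivKer 𝓘(ℝ, E) 𝓘(ℝ, F) (fun g : G => φ g • y)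
      1)).congr_of_eventuallyEq hconst)
  exact (injective_iff_map_eq_zero _).2 fun v hv => DFunLike.congr_fun hzero
    (⟨v, hv⟩ : mfderivKer 𝓘(ℝ, E) 𝓘(ℝ, F) (fun g : G => φ g • y) 1)

end OrbitMaps

section Dressing

variable {ED : Type*} [NormedAddCommGroup ED] [NormedSpace ℝ ED]
  {D : Type*} [TopologicalSpace D] [ChartedSpace ED D] [Group D] [LieGroup 𝓘(ℝ, ED) ∞ D]
  {ES : Type*} [NormedAddCommGroup ES] [NormedSpace ℝ ES]

theorem contMDiff_smul_coset [CompleteSpace ED] [FiniteDimensional ℝ ES] {Γ : Subgroup D}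
    [ChartedSpace ES (D ⧸ Γ)] [IsManifold 𝓘(ℝ, ES) ∞ (D ⧸ Γ)]
    (hsmooth : ContMDiff 𝓘(ℝ, ED) 𝓘(ℝ, ES) ∞ (fun a : D => (a : D ⧸ Γ)))
    (hsubmersion : ∀ a : D,
      Surjective (mfderiv 𝓘(ℝ, ED) 𝓘(ℝ, ES) (fun a : D => (a : D ⧸ Γ)) a)) (a : D) :
    ContMDiff 𝓘(ℝ, ES) 𝓘(ℝ, ES) ∞ (fun s : D ⧸ Γ => a • s) := by
  have : IsManifold 𝓘(ℝ, ED) ∞ D := LieGroup.toContMDiffMul.toIsManifold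
  intro s
  obtain ⟨b, rfl⟩ := QuotientGroup.mk_surjective s
  obtain ⟨σ, -, hσ, hqσ⟩ :=
    exists_smooth_local_section (smoothNear_of_contMDiff hsmooth b) (hsubmersion b)
  have hlift : SmoothNear 𝓘(ℝ, ES) 𝓘(ℝ, ES) (fun s => ((a * σ s : D) : D ⧸ Γ)) (b : D ⧸ Γ) :=
    (smoothNear_of_contMDiff (hsmooth.comp contMDiff_mul_left) _).comp hσ rfl
  refine hlift.contMDiffAt.congr_of_eventuallyEq ?_
  filter_upwards [hqσ] with s hs
  exact congrArg (a • ·) hs.symm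

theorem SplitManinPair.contMDiff_orbitMap {EG : Type*} [NormedAddCommGroup EG] [NormedSpace ℝ EG]
    {G : Type*} [TopologicalSpace G] [ChartedSpace EG G] [Group G] (P : SplitManinPair ED D EG G)
    [ChartedSpace ES P.S] (hsmooth : ContMDiff 𝓘(ℝ, ED) 𝓘(ℝ, ES) ∞ (fun a : D => (a : P.S)))
    (y : P.S) : ContMDiff 𝓘(ℝ, EG) 𝓘(ℝ, ES) ∞ (fun g : G => P.incl g • y) := by
  obtain ⟨b, rfl⟩ := QuotientGroup.mk_surjective y
  exact hsmooth.comp (contMDiff_mul_right.comp P.incl_smooth)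

end Dressing

/-! ### Bivector fields, submersions and infinitesimal actions -/

section Bivector

variable {EM : Type*} [NormedAddCommGroup EM] [NormedSpace ℝ EM]
  {M : Type*} [TopologicalSpace M] [ChartedSpace EM M]

theorem hasMFDerivAt_mvfderiv {F : M → ℝ} (hF : ContMDiff 𝓘(ℝ, EM) 𝓘(ℝ, ℝ) ∞ F) (x : M) :
    HasMFDerivAt 𝓘(ℝ, EM) 𝓘(ℝ, ℝ) F x (mvfderiv 𝓘(ℝ, EM) F x) :=
  (hF.mdifferentiable (by simp) x).hasMFDerivAt

namespace BivectorField

variable (π : BivectorField EM M)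

theorem bracket_self (F : M → ℝ) (x : M) : π.bracket F F x = 0 := π.skew x _

theorem bracket_swap (F K : M → ℝ) (x : M) : π.bracket F K x = - π.bracket K F x := by
  have h := π.skew x (mvfderiv 𝓘(ℝ, EM) F x + mvfderiv 𝓘(ℝ, EM) K x)
  have h1 := π.skew x (mvfderiv 𝓘(ℝ, EM) F x)
  have h2 := π.skew x (mvfderiv 𝓘(ℝ, EM) K x)
  rw [map_add, map_add, add_apply, add_apply, h1, h2] at h
  unfold bracket
  linarith

theorem bracket_add_right (F : M → ℝ) {K K' : M → ℝ} (hK : ContMDiff 𝓘(ℝ, EM) 𝓘(ℝ, ℝ) ∞ K)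
    (hK' : ContMDiff 𝓘(ℝ, EM) 𝓘(ℝ, ℝ) ∞ K') (x : M) :
    π.bracket F (K + K') x = π.bracket F K x + π.bracket F K' x := by
  rw [bracket, mvfderiv_add (hK.mdifferentiable (by simp) x) (hK'.mdifferentiable (by simp) x)]
  rfl

theorem bracket_sub_right (F : M → ℝ) {K K' : M → ℝ} (hK : ContMDiff 𝓘(ℝ, EM) 𝓘(ℝ, ℝ) ∞ K)
    (hK' : ContMDiff 𝓘(ℝ, EM) 𝓘(ℝ, ℝ) ∞ K') (x : M) :
    π.bracket F (K - K') x = π.bracket F K x - π.bracket F K' x := by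
  rw [bracket, mvfderiv_sub (hK.mdifferentiable (by simp) x) (hK'.mdifferentiable (by simp) x)]
  rfl

theorem bracket_mul_right (F : M → ℝ) {K K' : M → ℝ} (hK : ContMDiff 𝓘(ℝ, EM) 𝓘(ℝ, ℝ) ∞ K)
    (hK' : ContMDiff 𝓘(ℝ, EM) 𝓘(ℝ, ℝ) ∞ K') (x : M) :
    π.bracket F (K * K') x = π.bracket F K x * K' x + K x * π.bracket F K' x := by
  unfold bracket
  rw [mvfderiv_mul (hK.mdifferentiable (by simp) x) (hK'.mdifferentiable (by simp) x)]
  simp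
  ring

theorem bracket_const_mul_right (F : M → ℝ) (c : ℝ) {K : M → ℝ}
    (hK : ContMDiff 𝓘(ℝ, EM) 𝓘(ℝ, ℝ) ∞ K) (x : M) :
    π.bracket F (fun z => c * K z) x = c * π.bracket F K x := by
  have hc : π.bracket F (fun _ => c) x = 0 := by
    rw [bracket, mvfderiv_const]
    rfl
  have hmul := π.bracket_mul_right F (K := fun _ => c) contMDiff_const hK x
  rwa [hc, zero_mul, zero_add] at hmul

end BivectorField

end Bivector

section Submersion

theorem finrank_ker_le_of_surjective {K V W : Type*} [DivisionRing K] [AddCommGroup V] [Module K V]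
    [FiniteDimensional K V] [AddCommGroup W] [Module K W] [FiniteDimensional K W] {T : V →ₗ[K] W}
    (hT : Surjective T) (T' : V →ₗ[K] W) : finrank K T.ker ≤ finrank K T'.ker := by
  have hrange := T'.range.finrank_le
  have hsum := T.finrank_range_add_finrank_ker
  have hsum' := T'.finrank_range_add_finrank_ker
  rw [LinearMap.range_eq_top.2 hT, finrank_top] at hsum
  omega

theorem exists_eq_comp_of_ker_le {V W : Type*} [NormedAddCommGroup V] [NormedSpace ℝ V]
    [NormedAddCommGroup W] [NormedSpace ℝ W] [FiniteDimensional ℝ W] {T : V →L[ℝ] W}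
    (hT : Surjective T) {β : V →L[ℝ] ℝ} (h : T.ker ≤ β.ker) : ∃ α : W →L[ℝ] ℝ, β = α ∘L T := by
  obtain ⟨B, hB⟩ := T.exists_rightInverse_of_surjective (LinearMap.range_eq_top.2 hT)
  refine ⟨β ∘L B, ContinuousLinearMap.ext fun v => ?_⟩
  have hker : v - B (T v) ∈ T.ker :=
    (map_sub T _ _).trans (sub_eq_zero.2 (DFunLike.congr_fun hB (T v)).symm)
  exact sub_eq_zero.1 ((map_sub β _ _).symm.trans (h hker))

variable {EM : Type*} [NormedAddCommGroup EM] [NormedSpace ℝ EM] [FiniteDimensional ℝ EM]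
  {M : Type*} [TopologicalSpace M] [ChartedSpace EM M] [IsManifold 𝓘(ℝ, EM) ∞ M]
  {EN : Type*} [NormedAddCommGroup EN] [NormedSpace ℝ EN] [FiniteDimensional ℝ EN]
  {N : Type*} [TopologicalSpace N] [ChartedSpace EN N] [IsManifold 𝓘(ℝ, EN) ∞ N]

theorem nonempty_fibreChart_of_surjective {f : M → N} {x : M}
    (hf : SmoothNear 𝓘(ℝ, EM) 𝓘(ℝ, EN) f x)
    (hsurj : Surjective (mfderiv 𝓘(ℝ, EM) 𝓘(ℝ, EN) f x)) :
    Nonempty (FibreChart f x (mfderivKer 𝓘(ℝ, EM) 𝓘(ℝ, EN) f x)) :=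
  nonempty_fibreChart hf (.of_forall fun _ => finrank_ker_le_of_surjective
    (T := (mfderiv 𝓘(ℝ, EM) 𝓘(ℝ, EN) f x : EM →L[ℝ] EN).toLinearMap) hsurj _)

theorem exists_mvfderiv_eq_comp {f : M → N} {x : M} (hf : ContMDiff 𝓘(ℝ, EM) 𝓘(ℝ, EN) ∞ f)
    (hsurj : Surjective (mfderiv 𝓘(ℝ, EM) 𝓘(ℝ, EN) f x)) {F : M → ℝ}
    (hF : ContMDiff 𝓘(ℝ, EM) 𝓘(ℝ, ℝ) ∞ F) (hF0 : ∀ᶠ z in 𝓝 x, f z = f x → F z = 0) :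
    ∃ α : TangentSpace 𝓘(ℝ, EN) (f x) →L[ℝ] ℝ,
      mvfderiv 𝓘(ℝ, EM) F x = α ∘L mfderiv 𝓘(ℝ, EM) 𝓘(ℝ, EN) f x := by
  obtain ⟨κ⟩ := nonempty_fibreChart_of_surjective (smoothNear_of_contMDiff hf x) hsurj
  have hzero : ∀ᶠ t in 𝓝 0, F (κ.param t) = 0 := by
    filter_upwards [κ.smoothNear_param.tendsto κ.param_zero hF0, κ.apply_param] with t hFt hft
    exact hFt hft
  have hcomp := hasMFDerivAt_unique
    (hasMFDerivAt_comp (E' := EM) (E'' := ℝ) (hasMFDerivAt_mvfderiv hF x)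
      κ.hasMFDerivAt_param κ.param_zero)
    ((hasMFDerivAt_const (0 : ℝ) _).congr_of_eventuallyEq hzero)
  exact exists_eq_comp_of_ker_le (V := EM) (W := EN) hsurj
    fun w hw => DFunLike.congr_fun hcomp (⟨w, hw⟩ : mfderivKer 𝓘(ℝ, EM) 𝓘(ℝ, EN) f x)

end Submersion

theorem isLocallyConstant_of_hasMFDerivAt_zero {E : Type*} [NormedAddCommGroup E] [NormedSpace ℝ E]
    {M : Type*} [TopologicalSpace M] [ChartedSpace E M] [IsManifold 𝓘(ℝ, E) ∞ M]
    {F : Type*} [NormedAddCommGroup F] [NormedSpace ℝ F] {f : M → F}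
    (hf : ∀ x, HasMFDerivAt 𝓘(ℝ, E) 𝓘(ℝ, F) f x (0 : E →L[ℝ] F)) : IsLocallyConstant f := by
  refine (IsLocallyConstant.iff_eventually_eq f).2 fun x => ?_
  have hderiv : ∀ᶠ t in 𝓝 (0 : E), HasFDerivAt (fun t => f (localParam x t)) (0 : E →L[ℝ] F) t := by
    filter_upwards [smoothNear_localParam (E := E) x] with t ht
    exact hasMFDerivAt_iff_hasFDerivAt.1 ((hasMFDerivAt_comp (hf (localParam x t))
      (ht.mdifferentiableAt (by simp)).hasMFDerivAt rfl).congr_mfderiv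
        (ContinuousLinearMap.zero_comp _))
  have hconst := eventually_eq_of_fderiv_eq_zero hderiv
  rw [localParam_zero] at hconst
  filter_upwards [(smoothNear_localCoord (E := E) x).tendsto (localCoord_self x) hconst,
    eventually_localParam_localCoord (E := E) x]
    with z hz hxz
  rwa [Set.mem_preimage, Set.mem_ofPred_eq, hxz] at hz

section InfinitesimalAction

variable {EM : Type*} [NormedAddCommGroup EM] [NormedSpace ℝ EM]
  {M : Type*} [TopologicalSpace M] [ChartedSpace EM M]
  {EG : Type*} [NormedAddCommGroup EG] [NormedSpace ℝ EG]
  {G : Type*} [TopologicalSpace G] [ChartedSpace EG G] [Group G]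
  [MulAction G M] [ContMDiffSMul 𝓘(ℝ, EG) 𝓘(ℝ, EM) ∞ G M]

theorem contMDiff_orbit (x : M) : ContMDiff 𝓘(ℝ, EG) 𝓘(ℝ, EM) ∞ (fun a : G => a • x) :=
  contMDiff_id.smul contMDiff_const

theorem hasMFDerivAt_infAction (x : M) :
    HasMFDerivAt 𝓘(ℝ, EG) 𝓘(ℝ, EM) (fun a : G => a • x) 1 (infAction EG G EM x) :=
  ((contMDiff_orbit x).mdifferentiable (by simp) 1).hasMFDerivAt

theorem hasMFDerivAt_comp_orbit {F : M → ℝ} (hF : ContMDiff 𝓘(ℝ, EM) 𝓘(ℝ, ℝ) ∞ F) (x : M) :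
    HasMFDerivAt 𝓘(ℝ, EG) 𝓘(ℝ, ℝ) (fun a : G => F (a • x)) 1
      (mvfderiv 𝓘(ℝ, EM) F x ∘L infAction EG G EM x) :=
  hasMFDerivAt_comp (E := EG) (E' := EM) (E'' := ℝ)
    (hasMFDerivAt_mvfderiv hF x) (hasMFDerivAt_infAction x) (one_smul G x)

variable [IsManifold 𝓘(ℝ, EG) ∞ G]

theorem mvfderiv_infAction_eq {F : M → ℝ} (hF : ContMDiff 𝓘(ℝ, EM) 𝓘(ℝ, ℝ) ∞ F) (x : M) :
    mfderiv 𝓘(ℝ, EG) 𝓘(ℝ, ℝ) (fun w : EG => F (localParam (1 : G) w • x)) 0 =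
      mvfderiv 𝓘(ℝ, EM) F x ∘L infAction EG G EM x :=
  (hasMFDerivAt_comp (E' := EG) (E'' := ℝ)
    (hasMFDerivAt_comp_orbit hF x) (hasMFDerivAt_localParam (1 : G)) (localParam_zero 1)).mfderiv

theorem contMDiff_derivAlong_infAction [IsManifold 𝓘(ℝ, EM) ∞ M] {F : M → ℝ}
    (hF : ContMDiff 𝓘(ℝ, EM) 𝓘(ℝ, ℝ) ∞ F) (v : GroupLieAlgebra 𝓘(ℝ, EG) G) :
    ContMDiff 𝓘(ℝ, EM) 𝓘(ℝ, ℝ) ∞ (derivAlong (fun x => infAction EG G EM x v) F) := by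
  intro x₀
  let f : M → EG → ℝ := fun x w => F (localParam (1 : G) w • x)
  have hf : ContMDiffAt (𝓘(ℝ, EM).prod 𝓘(ℝ, EG)) 𝓘(ℝ, ℝ) ∞ (uncurry f) (x₀, 0) :=
    hF.contMDiffAt.comp _ (((smoothNear_localParam (1 : G)).contMDiffAt.comp (x₀, (0 : EG))
      contMDiffAt_snd).smul contMDiffAt_fst)
  let df : M → EG →L[ℝ] ℝ := fun x => mfderiv 𝓘(ℝ, EG) 𝓘(ℝ, ℝ) (f x) 0
  have hdf : ContMDiffAt 𝓘(ℝ, EM) 𝓘(ℝ, EG →L[ℝ] ℝ) ∞ df x₀ := by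
    have h := ContMDiffAt.mfderiv (m := ∞) f (fun _ => (0 : EG)) hf contMDiffAt_const (by simp)
    rwa [inTangentCoordinates_model_space (I := 𝓘(ℝ, EG)) (I' := 𝓘(ℝ, ℝ)) _ _ df] at h
  have happ := hdf.clm_apply (contMDiffAt_const (I' := 𝓘(ℝ, EG)) (M' := EG) (c := v))
  exact happ.congr_of_eventuallyEq <| .of_forall fun x =>
    (DFunLike.congr_fun (mvfderiv_infAction_eq hF x) v).symm

end InfinitesimalAction

/-! ### The reduced bracket -/

namespace SplitManinPair

variable {ED : Type*} [NormedAddCommGroup ED] [NormedSpace ℝ ED]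
  {D : Type*} [TopologicalSpace D] [ChartedSpace ED D] [Group D]
  {EG : Type*} [NormedAddCommGroup EG] [NormedSpace ℝ EG]
  {G : Type*} [TopologicalSpace G] [ChartedSpace EG G] [Group G]
  (P : SplitManinPair ED D EG G) (y : P.S)

/-- The orbit map `G → 𝒪` onto the dressing orbit of `y`. -/
def orbitPoint (g : G) : P.DressingOrbit y := ⟨P.incl g • y, g, rfl⟩

theorem continuous_orbitPoint : Continuous (P.orbitPoint y) :=
  continuous_iff_coinduced_le.2 le_rfl

theorem isOpenMap_orbitPoint [ContinuousMul G] : IsOpenMap (P.orbitPoint y) := by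
  intro V hV
  have hpreimage : P.orbitPoint y ⁻¹' (P.orbitPoint y '' V) =
      ⋃ k ∈ {k : G | P.incl k • y = y}, (· * k) ⁻¹' V := by
    ext g
    simp only [Set.mem_preimage, Set.mem_image, Set.mem_iUnion, exists_prop, Set.mem_ofPred_eq]
    constructor
    · rintro ⟨h, hV, hgh⟩
      refine ⟨g⁻¹ * h, ?_, by rwa [mul_inv_cancel_left]⟩
      rw [map_mul, mul_smul, map_inv, inv_smul_eq_iff]
      exact congrArg Subtype.val hgh
    · rintro ⟨k, hk, hV⟩
      refine ⟨g * k, hV, Subtype.ext (?_ : P.incl (g * k) • y = P.incl g • y)⟩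
      rw [map_mul, mul_smul, hk]
  refine isOpen_coinduced.2 ?_
  change IsOpen (P.orbitPoint y ⁻¹' (P.orbitPoint y '' V))
  rw [hpreimage]
  exact isOpen_biUnion fun k _ => hV.preimage (continuous_mul_const k)

end SplitManinPair

theorem lieBracketR_self {ED : Type*} [NormedAddCommGroup ED] [NormedSpace ℝ ED]
    {D : Type*} [TopologicalSpace D] [ChartedSpace ED D] [Group D]
    (u : GroupLieAlgebra 𝓘(ℝ, ED) D) : lieBracketR u u = 0 :=
  congrFun VectorField.mlieBracket_self 1

namespace HamiltonianSpace

variable {ED : Type*} [NormedAddCommGroup ED] [NormedSpace ℝ ED]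
  {D : Type*} [TopologicalSpace D] [ChartedSpace ED D] [Group D]
  {EG : Type*} [NormedAddCommGroup EG] [NormedSpace ℝ EG] [FiniteDimensional ℝ EG]
  {G : Type*} [TopologicalSpace G] [ChartedSpace EG G] [Group G]
  {P : SplitManinPair ED D EG G}
  {ES : Type*} [NormedAddCommGroup ES] [NormedSpace ℝ ES] [ChartedSpace ES P.S]
  {EM : Type*} [NormedAddCommGroup EM] [NormedSpace ℝ EM]
  {M : Type*} [TopologicalSpace M] [ChartedSpace EM M] [MulAction G M]

section Topology

variable (H : HamiltonianSpace P ES EM M) {y : P.S}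

theorem val_smul (g : G) (q : H.Preimage y) : (g • q).1 = g • q.1 := rfl

theorem continuous_val : Continuous (fun q : H.Preimage y => q.1) :=
  continuous_iff_le_induced.2 inf_le_left

theorem continuous_toOrbit : Continuous (H.toOrbit y) :=
  continuous_iff_le_induced.2 inf_le_right

theorem nhds_preimage (q : H.Preimage y) :
    𝓝 q = comap (fun q : H.Preimage y => q.1) (𝓝 q.1) ⊓
      comap (H.toOrbit y) (𝓝 (H.toOrbit y q)) :=
  nhds_inf.trans (congrArg₂ _ (nhds_induced _ _) (nhds_induced _ _))

theorem tendsto_preimage_iff {Z : Type*} {l : Filter Z} {f : Z → H.Preimage y} {q : H.Preimage y} :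
    Tendsto f l (𝓝 q) ↔ Tendsto (fun z => (f z).1) l (𝓝 q.1) ∧
      Tendsto (fun z => H.toOrbit y (f z)) l (𝓝 (H.toOrbit y q)) := by
  rw [nhds_preimage, tendsto_inf, tendsto_comap_iff, tendsto_comap_iff]
  rfl

theorem eventually_of_mem_fibre {q : H.Preimage y} {Q : M → Prop} (hQ : ∀ᶠ q' in 𝓝 q, Q q'.1) :
    ∀ᶠ z in 𝓝 q.1, H.J z = H.J q.1 → Q z := by
  rw [nhds_preimage] at hQ
  obtain ⟨A, ⟨A', hA', hA⟩, B, ⟨B', hB', hB⟩, hAB⟩ :=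
    mem_inf_iff_superset.1 (eventually_iff.1 hQ)
  filter_upwards [hA'] with z hz hJ
  let q' : H.Preimage y := ⟨z, hJ ▸ q.2⟩
  have horbit : H.toOrbit y q' = H.toOrbit y q := Subtype.ext hJ
  exact hAB (a := q') ⟨hA hz, hB (horbit ▸ mem_of_mem_nhds hB' : H.toOrbit y q' ∈ B')⟩

theorem continuous_orbit_preimage [ContinuousMul G] [ContinuousSMul G M] (q : H.Preimage y) :
    Continuous (fun g : G => g • q) := by
  obtain ⟨h, hh⟩ := q.2
  have horbit : (fun g : G => H.toOrbit y (g • q)) = P.orbitPoint y ∘ (· * h) := by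
    refine funext fun g => Subtype.ext ?_
    change H.J (g • q.1) = P.incl (g * h) • y
    rw [H.J_equivariant, map_mul, mul_smul, hh]
  have hcont : Continuous (fun g : G => H.toOrbit y (g • q)) :=
    horbit ▸ (P.continuous_orbitPoint y).comp (continuous_mul_const h)
  exact continuous_iff_continuousAt.2 fun g => H.tendsto_preimage_iff.2
    ⟨(continuous_id.smul continuous_const).continuousAt, hcont.continuousAt⟩

theorem eventually_exists_incl_smul_eq [ContinuousMul G] {q : H.Preimage y} (hq : H.J q.1 = y)
    {Q : G × M → Prop} (hQ : ∀ᶠ r in 𝓝 ((1 : G), q.1), Q r) :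
    ∀ᶠ q' in 𝓝 q, ∃ h, P.incl h • y = H.J q'.1 ∧ Q (h, q'.1) := by
  rw [nhds_prod_eq] at hQ
  obtain ⟨A, hA, B, hB, hAB⟩ := eventually_prod_iff.1 hQ
  have hqy : P.orbitPoint y 1 = H.toOrbit y q :=
    Subtype.ext <| (congrArg (· • y) (map_one P.incl)).trans ((one_smul D y).trans hq.symm)
  have himage : P.orbitPoint y '' {h | A h} ∈ 𝓝 (H.toOrbit y q) :=
    hqy ▸ (P.isOpenMap_orbitPoint y).image_mem_nhds hA
  filter_upwards [H.continuous_toOrbit.continuousAt himage,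
    H.continuous_val.continuousAt.eventually hB] with q' ⟨h, hAh, hh⟩ hBq
  exact ⟨h, congrArg Subtype.val hh, hAB hAh hBq⟩

end Topology

variable {H : HamiltonianSpace P ES EM M} {y : P.S}

section Regular

variable [ContMDiffSMul 𝓘(ℝ, EG) 𝓘(ℝ, EM) ∞ G M]

theorem IsRegularValue.surjective_mfderiv (hy : H.IsRegularValue y)
    (hdress : ∀ a : D, ContMDiff 𝓘(ℝ, ES) 𝓘(ℝ, ES) ∞ (fun s : P.S => a • s)) (q : H.Preimage y) :
    Surjective (mfderiv 𝓘(ℝ, EM) 𝓘(ℝ, ES) H.J q.1) := by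
  obtain ⟨g, hg⟩ := q.2
  have hJ : H.J (g⁻¹ • q.1) = y := by rw [H.J_equivariant, ← hg, map_inv, inv_smul_smul]
  have hsurj := surjective_mfderiv_smul (φ := P.incl) (f := H.J)
    (ContMDiffSMul.contMDiff_const_smul (I := 𝓘(ℝ, EG))) hdress H.J_equivariant
    (H.J_smooth.mdifferentiable (by simp)) g (hy _ hJ)
  rwa [smul_inv_smul] at hsurj

end Regular

section Extension

theorem IsExtensionAt.eventually {F : M → ℝ} {f : H.Preimage y → ℝ} {q : H.Preimage y}
    (h : IsExtensionAt F f q) : ∀ᶠ q' in 𝓝 q, IsExtensionAt F f q' :=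
  (eventually_eventually_nhds.2 h.2).mono fun _ hq' => ⟨h.1, hq'⟩

theorem IsExtensionAt.apply_eq {F : M → ℝ} {f : H.Preimage y → ℝ} {q : H.Preimage y}
    (h : IsExtensionAt F f q) : F q.1 = f q :=
  h.2.self_of_nhds

theorem IsExtensionAt.sub {F F' : M → ℝ} {f : H.Preimage y → ℝ} {q : H.Preimage y}
    (hF : IsExtensionAt F f q) (hF' : IsExtensionAt F' f q) :
    IsExtensionAt (F - F') (0 : H.Preimage y → ℝ) q := by
  refine ⟨hF.1.sub hF'.1, ?_⟩
  filter_upwards [hF.2, hF'.2] with q' hq hq'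
  exact sub_eq_zero.2 (hq.trans hq'.symm)

theorem IsExtensionAt.add {F K : M → ℝ} {f k : H.Preimage y → ℝ} {q : H.Preimage y}
    (hF : IsExtensionAt F f q) (hK : IsExtensionAt K k q) :
    IsExtensionAt (F + K) (f + k) q :=
  ⟨hF.1.add hK.1, (hF.2.and hK.2).mono fun _ h => congrArg₂ (· + ·) h.1 h.2⟩

theorem IsExtensionAt.mul {F K : M → ℝ} {f k : H.Preimage y → ℝ} {q : H.Preimage y}
    (hF : IsExtensionAt F f q) (hK : IsExtensionAt K k q) :
    IsExtensionAt (F * K) (f * k) q :=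
  ⟨hF.1.mul hK.1, (hF.2.and hK.2).mono fun _ h => congrArg₂ (· * ·) h.1 h.2⟩

theorem IsExtensionAt.smul {F : M → ℝ} {f : H.Preimage y → ℝ} {q : H.Preimage y}
    (hF : IsExtensionAt F f q) (c : ℝ) : IsExtensionAt (fun z => c * F z) (c • f) q :=
  ⟨contMDiff_const.mul hF.1, hF.2.mono fun _ h => congrArg (c * ·) h⟩

variable [LieGroup 𝓘(ℝ, EG) ∞ G] [ContMDiffSMul 𝓘(ℝ, EG) 𝓘(ℝ, EM) ∞ G M]

theorem tendsto_smul_one (q : H.Preimage y) : Tendsto (fun g : G => g • q) (𝓝 1) (𝓝 q) := by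
  have := topologicalGroup_of_lieGroup 𝓘(ℝ, EG) (G := G) ∞
  have : ContinuousSMul G M := ContMDiffSMul.continuousSMul (I := 𝓘(ℝ, EG)) (I' := 𝓘(ℝ, EM)) ∞
  simpa only [one_smul] using (H.continuous_orbit_preimage q).tendsto 1

theorem IsExtensionAt.hasMFDerivAt_orbit {F : M → ℝ} {f : H.Preimage y → ℝ} {q : H.Preimage y}
    (hF : IsExtensionAt F f q) :
    HasMFDerivAt 𝓘(ℝ, EG) 𝓘(ℝ, ℝ) (fun g : G => f (g • q)) 1
      (mvfderiv 𝓘(ℝ, EM) F q.1 ∘L infAction EG G EM q.1) :=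
  (hasMFDerivAt_comp_orbit hF.1 q.1).congr_of_eventuallyEq
    (((tendsto_smul_one q).eventually hF.2).mono fun _ hg => hg.symm)

theorem IsExtensionAt.mvfderiv_comp_infAction {F : M → ℝ} {f : H.Preimage y → ℝ}
    {q : H.Preimage y} (hF : IsExtensionAt F f q) (hf : ∀ (g : G) p, f (g • p) = f p) :
    mvfderiv 𝓘(ℝ, EM) F q.1 ∘L infAction EG G EM q.1 = 0 :=
  hasMFDerivAt_unique hF.hasMFDerivAt_orbit <|
    (hasMFDerivAt_const (f q) (1 : G)).congr_of_eventuallyEq (.of_forall fun g => hf g q)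

theorem IsExtensionAt.derivAlong [IsManifold 𝓘(ℝ, EM) ∞ M] {F : M → ℝ} {f : H.Preimage y → ℝ}
    {q : H.Preimage y} (hF : IsExtensionAt F f q) (hf : ∀ (g : G) p, f (g • p) = f p)
    (v : GroupLieAlgebra 𝓘(ℝ, EG) G) :
    IsExtensionAt (derivAlong (fun x => infAction EG G EM x v) F) (0 : H.Preimage y → ℝ) q :=
  ⟨contMDiff_derivAlong_infAction hF.1 v, hF.eventually.mono fun _ hq' =>
    DFunLike.congr_fun (hq'.mvfderiv_comp_infAction hf) v⟩

end Extension

/-- A choice of a smooth extension of `f` near `q`. -/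
noncomputable def extensionAt (f : H.invariantFunctions y) (q : H.Preimage y) : M → ℝ :=
  Classical.choose (f.2.1 q)

theorem isExtensionAt_extensionAt (f : H.invariantFunctions y) (q : H.Preimage y) :
    IsExtensionAt (extensionAt f q) f.1 q := Classical.choose_spec (f.2.1 q)

theorem IsReducedBracket.unique {br br' : PoissonBracket (H.invariantFunctions y)}
    (h : H.IsReducedBracket br) (h' : H.IsReducedBracket br') : br' = br := by
  refine PoissonBracket.ext (LinearMap.ext₂ fun f k => Subtype.ext <| funext fun q => ?_)
  rw [h f k q _ _ (isExtensionAt_extensionAt f q) (isExtensionAt_extensionAt k q),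
    h' f k q _ _ (isExtensionAt_extensionAt f q) (isExtensionAt_extensionAt k q)]

/-- The reduced bracket of two invariant functions, as a function on `J⁻¹(𝒪)`. -/
noncomputable def reducedFun (f k : H.invariantFunctions y) (q : H.Preimage y) : ℝ :=
  H.π.bracket (extensionAt f q) (extensionAt k q) q.1

theorem reducedFun_swap (f k : H.invariantFunctions y) (q : H.Preimage y) :
    reducedFun f k q = - reducedFun k f q :=
  BivectorField.bracket_swap _ _ _ _

section Bracket

variable [LieGroup 𝓘(ℝ, EG) ∞ G] [FiniteDimensional ℝ ES] [IsManifold 𝓘(ℝ, ES) ∞ P.S]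
  [FiniteDimensional ℝ EM] [IsManifold 𝓘(ℝ, EM) ∞ M]
  [ContMDiffSMul 𝓘(ℝ, EG) 𝓘(ℝ, EM) ∞ G M]

/-- The differential of a function vanishing along the fibre of `J` lies in the image of `J*`, and
`π♯ J* = ρ_M σ^∨` points along the orbits, which invariant functions do not see. -/
theorem bracket_eq_zero {F K : M → ℝ} {k : H.Preimage y → ℝ} {q : H.Preimage y}
    (hreg : Surjective (mfderiv 𝓘(ℝ, EM) 𝓘(ℝ, ES) H.J q.1))
    (hF : IsExtensionAt F (0 : H.Preimage y → ℝ) q) (hK : IsExtensionAt K k q)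
    (hk : ∀ (g : G) p, k (g • p) = k p) : H.π.bracket F K q.1 = 0 := by
  obtain ⟨α, hα⟩ := exists_mvfderiv_eq_comp H.J_smooth hreg hF.1 (H.eventually_of_mem_fibre hF.2)
  rw [BivectorField.bracket, hα, H.moment]
  exact DFunLike.congr_fun (hK.mvfderiv_comp_infAction hk) (P.sigmaDual (H.J q.1) α)

theorem bracket_congr_right {F K K' : M → ℝ} {f k : H.Preimage y → ℝ} {q : H.Preimage y}
    (hreg : Surjective (mfderiv 𝓘(ℝ, EM) 𝓘(ℝ, ES) H.J q.1))
    (hF : IsExtensionAt F f q) (hK : IsExtensionAt K k q) (hK' : IsExtensionAt K' k q)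
    (hf : ∀ (g : G) p, f (g • p) = f p) : H.π.bracket F K q.1 = H.π.bracket F K' q.1 := by
  have h := bracket_eq_zero hreg (hK.sub hK') hF hf
  rw [BivectorField.bracket_swap, BivectorField.bracket_sub_right _ _ hK.1 hK'.1] at h
  linarith

theorem bracket_congr {F F' K K' : M → ℝ} {f k : H.Preimage y → ℝ} {q : H.Preimage y}
    (hreg : Surjective (mfderiv 𝓘(ℝ, EM) 𝓘(ℝ, ES) H.J q.1))
    (hF : IsExtensionAt F f q) (hF' : IsExtensionAt F' f q)
    (hK : IsExtensionAt K k q) (hK' : IsExtensionAt K' k q)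
    (hf : ∀ (g : G) p, f (g • p) = f p) (hk : ∀ (g : G) p, k (g • p) = k p) :
    H.π.bracket F K q.1 = H.π.bracket F' K' q.1 := by
  rw [bracket_congr_right hreg hF hK hK' hf, BivectorField.bracket_swap,
    bracket_congr_right hreg hK' hF hF' hk, ← BivectorField.bracket_swap]

theorem mvfderiv_bracket_comp_infAction {F K : M → ℝ} {f k : H.Preimage y → ℝ}
    {q : H.Preimage y} (hreg : Surjective (mfderiv 𝓘(ℝ, EM) 𝓘(ℝ, ES) H.J q.1))
    (hF : IsExtensionAt F f q) (hK : IsExtensionAt K k q)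
    (hf : ∀ (g : G) p, f (g • p) = f p) (hk : ∀ (g : G) p, k (g • p) = k p) :
    mvfderiv 𝓘(ℝ, EM) (H.π.bracket F K) q.1 ∘L infAction EG G EM q.1 = 0 := by
  ext v
  have h := H.lie_eq v F K hF.1 hK.1 q.1
  rw [hF.mvfderiv_comp_infAction hf, hK.mvfderiv_comp_infAction hk, SplitManinPair.cobracket,
    BivectorField.lieDerivative, lieBracketR_self, map_zero, LinearMap.zero_apply, neg_zero,
    Pi.sub_apply, Pi.sub_apply, bracket_eq_zero hreg (hF.derivAlong hf v) hK hk,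
    BivectorField.bracket_swap _ F, bracket_eq_zero hreg (hK.derivAlong hk v) hF hf, neg_zero,
    sub_zero, sub_zero] at h
  exact h

theorem reducedFun_eq {f k : H.invariantFunctions y} {q : H.Preimage y} {F K : M → ℝ}
    (hreg : Surjective (mfderiv 𝓘(ℝ, EM) 𝓘(ℝ, ES) H.J q.1))
    (hF : IsExtensionAt F f.1 q) (hK : IsExtensionAt K k.1 q) :
    reducedFun f k q = H.π.bracket F K q.1 :=
  bracket_congr hreg (isExtensionAt_extensionAt f q) hF (isExtensionAt_extensionAt k q) hK
    f.2.2 k.2.2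

variable (hreg : ∀ q : H.Preimage y, Surjective (mfderiv 𝓘(ℝ, EM) 𝓘(ℝ, ES) H.J q.1))

include hreg

theorem isExtensionAt_bracket {f k : H.invariantFunctions y} {q : H.Preimage y} {F K : M → ℝ}
    (hF : IsExtensionAt F f.1 q) (hK : IsExtensionAt K k.1 q) :
    IsExtensionAt (H.π.bracket F K) (reducedFun f k) q := by
  refine ⟨H.π.smooth F K hF.1 hK.1, ?_⟩
  filter_upwards [hF.eventually, hK.eventually] with q' hF' hK'
  exact (reducedFun_eq (hreg q') hF' hK').symm

theorem hasMFDerivAt_reducedFun_orbit (f k : H.invariantFunctions y) (q : H.Preimage y) (g : G) :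
    HasMFDerivAt 𝓘(ℝ, EG) 𝓘(ℝ, ℝ) (fun a : G => reducedFun f k (a • q)) g
      (0 : EG →L[ℝ] ℝ) := by
  have hF := isExtensionAt_extensionAt f (g • q)
  have hK := isExtensionAt_extensionAt k (g • q)
  have hone : HasMFDerivAt 𝓘(ℝ, EG) 𝓘(ℝ, ℝ) (fun a : G => reducedFun f k (a • g • q)) 1
      (0 : EG →L[ℝ] ℝ) :=
    (isExtensionAt_bracket hreg hF hK).hasMFDerivAt_orbit.congr_mfderiv
      (mvfderiv_bracket_comp_infAction (hreg (g • q)) hF hK f.2.2 k.2.2)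
  have hmul : MDifferentiable 𝓘(ℝ, EG) 𝓘(ℝ, EG) (fun a : G => a * g⁻¹) :=
    (contMDiff_mul_right (n := ∞)).mdifferentiable (by simp)
  refine ((hasMFDerivAt_comp hone (hmul g).hasMFDerivAt (mul_inv_cancel g)).congr_of_eventuallyEq
    (.of_forall fun a => ?_)).congr_mfderiv (ContinuousLinearMap.zero_comp _)
  simp only [← mul_smul, inv_mul_cancel_right]

theorem reducedFun_smul [ConnectedSpace G] (f k : H.invariantFunctions y) (g : G)
    (q : H.Preimage y) : reducedFun f k (g • q) = reducedFun f k q := by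
  have : IsManifold 𝓘(ℝ, EG) ∞ G := LieGroup.toContMDiffMul.toIsManifold
  have hconst := isLocallyConstant_of_hasMFDerivAt_zero
    (hasMFDerivAt_reducedFun_orbit hreg f k q)
  simpa only [one_smul] using hconst.apply_eq_of_preconnectedSpace g 1

theorem reducedFun_add_right (f k k' : H.invariantFunctions y) (q : H.Preimage y) :
    reducedFun f (k + k') q = reducedFun f k q + reducedFun f k' q := by
  have hF := isExtensionAt_extensionAt f q
  have hK := isExtensionAt_extensionAt k q
  have hK' := isExtensionAt_extensionAt k' q
  rw [reducedFun_eq (hreg q) hF (K := extensionAt k q + extensionAt k' q) (hK.add hK'),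
    BivectorField.bracket_add_right _ _ hK.1 hK'.1]
  rfl

theorem reducedFun_smul_right (f k : H.invariantFunctions y) (c : ℝ) (q : H.Preimage y) :
    reducedFun f (c • k) q = c * reducedFun f k q := by
  have hF := isExtensionAt_extensionAt f q
  have hK := isExtensionAt_extensionAt k q
  rw [reducedFun_eq (hreg q) hF (K := fun z => c * extensionAt k q z) (hK.smul c),
    BivectorField.bracket_const_mul_right _ _ _ hK.1]
  rfl

theorem reducedFun_mul_right (f k k' : H.invariantFunctions y) (q : H.Preimage y) :
    reducedFun f (k * k') q = reducedFun f k q * k'.1 q + k.1 q * reducedFun f k' q := by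
  have hF := isExtensionAt_extensionAt f q
  have hK := isExtensionAt_extensionAt k q
  have hK' := isExtensionAt_extensionAt k' q
  rw [reducedFun_eq (hreg q) hF (K := extensionAt k q * extensionAt k' q) (hK.mul hK'),
    BivectorField.bracket_mul_right _ _ hK.1 hK'.1, hK.apply_eq, hK'.apply_eq]
  rfl

/-- The reduced bracket of two invariant functions, as an invariant function. -/
noncomputable def reducedElem [ConnectedSpace G] (f k : H.invariantFunctions y) :
    H.invariantFunctions y :=
  ⟨reducedFun f k, fun q => ⟨_, isExtensionAt_bracket hreg (isExtensionAt_extensionAt f q)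
    (isExtensionAt_extensionAt k q)⟩, reducedFun_smul hreg f k⟩

theorem reducedFun_jacobi [ConnectedSpace G] (f k l : H.invariantFunctions y)
    (q : H.Preimage y) :
    reducedFun f (reducedElem hreg k l) q + reducedFun k (reducedElem hreg l f) q +
      reducedFun l (reducedElem hreg f k) q = 0 := by
  have hF := isExtensionAt_extensionAt f q
  have hK := isExtensionAt_extensionAt k q
  have hL := isExtensionAt_extensionAt l q
  have h := H.schouten_eq _ _ _ hF.1 hK.1 hL.1 q.1
  rw [hF.mvfderiv_comp_infAction f.2.2, hK.mvfderiv_comp_infAction k.2.2,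
    hL.mvfderiv_comp_infAction l.2.2, SplitManinPair.trivector, lieBracketR_self, map_zero,
    LinearMap.zero_apply] at h
  simp only [BivectorField.schouten, Pi.add_apply] at h
  rw [reducedFun_eq (k := reducedElem hreg k l) (hreg q) hF (isExtensionAt_bracket hreg hK hL),
    reducedFun_eq (k := reducedElem hreg l f) (hreg q) hK (isExtensionAt_bracket hreg hL hF),
    reducedFun_eq (k := reducedElem hreg f k) (hreg q) hL (isExtensionAt_bracket hreg hF hK)]
  linarith

/-- The reduced Poisson bracket on `C^∞(J⁻¹(𝒪))^G`. -/
noncomputable def reducedBracket [ConnectedSpace G] : PoissonBracket (H.invariantFunctions y) where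
  bracket := LinearMap.mk₂ ℝ (reducedElem hreg)
    (fun f f' k => Subtype.ext <| funext fun q => by
      change reducedFun (f + f') k q = reducedFun f k q + reducedFun f' k q
      rw [reducedFun_swap, reducedFun_add_right hreg, reducedFun_swap f, reducedFun_swap f',
        neg_add])
    (fun c f k => Subtype.ext <| funext fun q => by
      change reducedFun (c • f) k q = c * reducedFun f k q
      rw [reducedFun_swap, reducedFun_smul_right hreg, reducedFun_swap f, mul_neg])
    (fun f k k' => Subtype.ext <| funext fun q => reducedFun_add_right hreg f k k' q)
    (fun c f k => Subtype.ext <| funext fun q => reducedFun_smul_right hreg f k c q)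
  bracket_self _ := Subtype.ext <| funext fun _ => BivectorField.bracket_self _ _ _
  jacobi f k l := Subtype.ext <| funext fun q => reducedFun_jacobi hreg f k l q
  leibniz f k l := Subtype.ext <| funext fun q => reducedFun_mul_right hreg f k l q

theorem isReducedBracket_reducedBracket [ConnectedSpace G] :
    H.IsReducedBracket (reducedBracket hreg) :=
  fun _ _ q _ _ hF hK => reducedFun_eq (hreg q) hF hK

end Bracket

end HamiltonianSpace

/-! ### Local slices -/

section LinearSlice

variable {V W U : Type*} [NormedAddCommGroup V] [NormedSpace ℝ V] [FiniteDimensional ℝ V]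
  [NormedAddCommGroup W] [NormedSpace ℝ W] [FiniteDimensional ℝ W]
  [NormedAddCommGroup U] [NormedSpace ℝ U]

theorem exists_injective_isCompl_range (K : Submodule ℝ V) {d : ℕ}
    (hd : finrank ℝ K + d = finrank ℝ V) :
    ∃ L : EuclideanSpace ℝ (Fin d) →ₗ[ℝ] V, Injective L ∧ IsCompl K L.range := by
  obtain ⟨C, hC⟩ := K.exists_isCompl
  have hsum := Submodule.finrank_add_eq_of_isCompl hC
  have hdim : finrank ℝ (EuclideanSpace ℝ (Fin d)) = finrank ℝ C := by
    rw [finrank_euclideanSpace_fin]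
    omega
  let e := LinearEquiv.ofFinrankEq (EuclideanSpace ℝ (Fin d)) C hdim
  refine ⟨C.subtype ∘ₗ e.toLinearMap, C.injective_subtype.comp e.injective, ?_⟩
  rwa [LinearMap.range_comp_of_range_eq_top _ e.range, C.range_subtype]

theorem exists_linear_slice (T : W →L[ℝ] U) (hT : Surjective T) (ρ : V →L[ℝ] W)
    (hρ : Injective ρ) {K : Submodule ℝ W} (hK : K = T.ker) {N : Submodule ℝ V}
    (hN : N = (T ∘L ρ).ker) {d : ℕ} (hd : d = finrank ℝ W - (finrank ℝ U + finrank ℝ N)) :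
    ∃ (L : EuclideanSpace ℝ (Fin d) →L[ℝ] K) (e : (N × EuclideanSpace ℝ (Fin d)) ≃L[ℝ] K),
      K.subtypeL ∘L (e : N × EuclideanSpace ℝ (Fin d) →L[ℝ] K) =
        (ρ ∘L N.subtypeL).coprod (K.subtypeL ∘L L) ∧ Injective (ρ.coprod (K.subtypeL ∘L L)) := by
  subst hK
  let ι : N →ₗ[ℝ] T.ker := (ρ.toLinearMap ∘ₗ N.subtype).codRestrict T.ker fun t => hN.le t.2
  have hι : Injective ι := fun s t hst => Subtype.ext (hρ (congrArg Subtype.val hst))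
  have hrank := T.toLinearMap.finrank_range_add_finrank_ker
  rw [LinearMap.range_eq_top.2 hT, finrank_top] at hrank
  have hle := LinearMap.finrank_le_finrank_of_injective hι
  obtain ⟨L, hL, hcompl⟩ := exists_injective_isCompl_range ι.range (d := d) (by
    rw [LinearMap.finrank_range_of_inj hι]
    omega)
  have hker : (ι.coprod L).ker = ⊥ := by
    rw [LinearMap.ker_coprod_of_disjoint_range _ _ hcompl.disjoint, LinearMap.ker_eq_bot.2 hι,
      LinearMap.ker_eq_bot.2 hL, Submodule.prod_bot]
  have hrange : (ι.coprod L).range = ⊤ := by rw [LinearMap.range_coprod, hcompl.sup_eq_top]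
  let e := LinearEquiv.ofBijective (ι.coprod L)
    ⟨LinearMap.ker_eq_bot.1 hker, LinearMap.range_eq_top.1 hrange⟩
  refine ⟨L.toContinuousLinearMap, e.toContinuousLinearEquiv, rfl,
    (injective_iff_map_eq_zero _).2 ?_⟩
  rintro ⟨v, c⟩ hvc
  have hsum : ρ v + (L c : W) = 0 := hvc
  have hv : v ∈ N := by
    rw [hN]
    change T (ρ v) = 0
    rw [eq_neg_of_add_eq_zero_left hsum, map_neg, neg_eq_zero]
    exact (L c).2
  have hzero : (ι.coprod L) (⟨v, hv⟩, c) = 0 := Subtype.ext hsum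
  have hpair := LinearMap.ker_eq_bot'.1 hker _ hzero
  exact Prod.ext (congrArg Subtype.val (congrArg Prod.fst hpair) : v = 0)
    (congrArg Prod.snd hpair :)

end LinearSlice

section SmulParam

variable {EG : Type*} [NormedAddCommGroup EG] [NormedSpace ℝ EG]
  {G : Type*} [TopologicalSpace G] [ChartedSpace EG G]
  {EM : Type*} [NormedAddCommGroup EM] [NormedSpace ℝ EM]
  {M : Type*} [TopologicalSpace M] [ChartedSpace EM M]
  {V W : Type*} [NormedAddCommGroup V] [NormedSpace ℝ V] [NormedAddCommGroup W] [NormedSpace ℝ W]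
  {γ : V → G} {τ : W → M} {v : V} {w : W}

theorem SmoothNear.smul_prod [SMul G M] [ContMDiffSMul 𝓘(ℝ, EG) 𝓘(ℝ, EM) ∞ G M]
    (hγ : SmoothNear 𝓘(ℝ, V) 𝓘(ℝ, EG) γ v) (hτ : SmoothNear 𝓘(ℝ, W) 𝓘(ℝ, EM) τ w) :
    SmoothNear 𝓘(ℝ, V × W) 𝓘(ℝ, EM) (fun p : V × W => γ p.1 • τ p.2) (v, w) := by
  filter_upwards [hγ.comp (smoothNear_clm (ContinuousLinearMap.fst ℝ V W) (v, w)) rfl,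
    hτ.comp (smoothNear_clm (ContinuousLinearMap.snd ℝ V W) (v, w)) rfl] with p hp hp'
  exact hp.smul hp'

theorem hasMFDerivAt_smul_prod [Group G] [MulAction G M] [ContMDiffSMul 𝓘(ℝ, EG) 𝓘(ℝ, EM) ∞ G M]
    {γ' : V →L[ℝ] EG} {τ' : W →L[ℝ] EM} {x : M}
    (hγ : SmoothNear 𝓘(ℝ, V) 𝓘(ℝ, EG) γ v) (hτ : SmoothNear 𝓘(ℝ, W) 𝓘(ℝ, EM) τ w)
    (hγ' : HasMFDerivAt 𝓘(ℝ, V) 𝓘(ℝ, EG) γ v γ') (hτ' : HasMFDerivAt 𝓘(ℝ, W) 𝓘(ℝ, EM) τ w τ')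
    (hγv : γ v = 1) (hτw : τ w = x) :
    HasMFDerivAt 𝓘(ℝ, V × W) 𝓘(ℝ, EM) (fun p : V × W => γ p.1 • τ p.2) (v, w)
      (((infAction EG G EM x : EG →L[ℝ] EM) ∘L γ').coprod τ') := by
  have hΨ := (hγ.smul_prod hτ).hasMFDerivAt
  have hinl := hasMFDerivAt_unique
    (hasMFDerivAt_comp (f := fun u => (u, w)) hΨ
      (hasFDerivAt_prodMk_left v w).hasMFDerivAt rfl)
    ((hasMFDerivAt_comp (E' := EG) (E'' := EM) (hasMFDerivAt_infAction x) hγ'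
      hγv).congr_of_eventuallyEq (.of_forall fun u => by simp only [hτw]))
  have hinr := hasMFDerivAt_unique
    (hasMFDerivAt_comp (f := fun u => (v, u)) hΨ
      (hasFDerivAt_prodMk_right v w).hasMFDerivAt rfl)
    (hτ'.congr_of_eventuallyEq (.of_forall fun u => by simp only [hγv, one_smul]))
  exact hΨ.congr_mfderiv ((ContinuousLinearMap.coprod_comp_inl_inr (M₂ := EM) _).symm.trans
    (congrArg₂ ContinuousLinearMap.coprod hinl hinr))

end SmulParam

section LocalSlice

variable {EM : Type*} [NormedAddCommGroup EM] [NormedSpace ℝ EM]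
  {M : Type*} [TopologicalSpace M] [ChartedSpace EM M]

theorem FibreChart.exists_coord {Y : Type*} {f : M → Y} {x : M} {K : Submodule ℝ EM}
    (κ : FibreChart f x K) {V : Type*} [NormedAddCommGroup V] [NormedSpace ℝ V] [CompleteSpace V]
    {Ψ : V → M} (e : V ≃L[ℝ] K) (hΨ0 : Ψ 0 = x) (hΨ : SmoothNear 𝓘(ℝ, V) 𝓘(ℝ, EM) Ψ 0)
    (hΨ' : HasMFDerivAt 𝓘(ℝ, V) 𝓘(ℝ, EM) Ψ 0 (K.subtypeL ∘L (e : V →L[ℝ] K)))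
    (hfΨ : ∀ᶠ p in 𝓝 0, f (Ψ p) = f x) :
    ∃ s : M → V, SmoothNear 𝓘(ℝ, EM) 𝓘(ℝ, V) s x ∧ s x = 0 ∧
      ∀ᶠ z in 𝓝 x, f z = f x → Ψ (s z) = z := by
  set A' : EM →L[ℝ] K := mfderiv 𝓘(ℝ, EM) 𝓘(ℝ, K) κ.coord x
  have hA : HasMFDerivAt 𝓘(ℝ, EM) 𝓘(ℝ, K) κ.coord x A' := κ.smoothNear_coord.hasMFDerivAt
  have hid : A' ∘L K.subtypeL = ContinuousLinearMap.id ℝ K :=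
    hasMFDerivAt_unique (hasMFDerivAt_comp hA κ.hasMFDerivAt_param κ.param_zero)
      ((hasMFDerivAt_id (0 : K)).congr_of_eventuallyEq κ.coord_param)
  have hcoord0 : κ.coord (Ψ 0) = 0 := by rw [hΨ0, κ.coord_self]
  have hderiv : HasFDerivAt (fun p => κ.coord (Ψ p)) (e : V →L[ℝ] K) 0 := by
    refine ((hasMFDerivAt_comp hA hΨ' hΨ0).congr_mfderiv ?_).hasFDerivAt
    exact congrArg (· ∘L (e : V →L[ℝ] K)) hid
  obtain ⟨g, hg, hgl, hgr⟩ := exists_contDiff_local_inverse e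
    ((κ.smoothNear_coord.comp hΨ hΨ0).mono fun _ h => h.contDiffAt) hderiv
  have hg0 : g 0 = 0 := by simpa only [hcoord0] using hgl.self_of_nhds
  rw [hcoord0] at hg hgr
  have hsx : g (κ.coord x) = 0 := by rw [κ.coord_self, hg0]
  have hs : SmoothNear 𝓘(ℝ, EM) 𝓘(ℝ, V) (fun z => g (κ.coord z)) x :=
    SmoothNear.comp (hg.mono fun _ h => h.contMDiffAt) κ.smoothNear_coord κ.coord_self
  refine ⟨_, hs, hsx, ?_⟩
  have hΨs := (hΨ.comp hs hsx).tendsto (y := x) (by rw [hsx, hΨ0])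
  filter_upwards [κ.smoothNear_coord.tendsto κ.coord_self hgr, κ.param_coord, hΨs κ.param_coord,
    hs.tendsto hsx hfΨ] with z hz hzparam hΨparam hΨfibre hzfibre
  exact (hΨparam hΨfibre).symm.trans ((congrArg κ.param hz).trans (hzparam hzfibre))

/-- A slice at `x` to the action of a group `G` near `1` on the fibre of `f` through `x`,
parametrized by `ℝᵈ`, with a smooth map `coord` that recovers the parameter from a translate of a
point of the slice. -/
structure LocalSlice (EM : Type*) [NormedAddCommGroup EM] [NormedSpace ℝ EM] {M : Type*}
    [TopologicalSpace M] [ChartedSpace EM M] (G : Type*) [TopologicalSpace G] [Group G]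
    [MulAction G M] {Y : Type*} (f : M → Y) (x : M) (d : ℕ) where
  param : EuclideanSpace ℝ (Fin d) → M
  coord : M → EuclideanSpace ℝ (Fin d)
  param_zero : param 0 = x
  smoothNear_param : SmoothNear (𝓡 d) 𝓘(ℝ, EM) param 0
  smoothNear_coord : SmoothNear 𝓘(ℝ, EM) (𝓡 d) coord x
  apply_param : ∀ᶠ c in 𝓝 0, f (param c) = f x
  coord_smul_param :
    ∀ᶠ q in 𝓝 ((1 : G), (0 : EuclideanSpace ℝ (Fin d))), coord (q.1 • param q.2) = q.2
  exists_smul_param_coord :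
    ∀ U ∈ 𝓝 (1 : G), ∀ᶠ z in 𝓝 x, f z = f x → ∃ g ∈ U, g • param (coord z) = z

variable {EG : Type*} [NormedAddCommGroup EG] [NormedSpace ℝ EG]
  {G : Type*} [TopologicalSpace G] [ChartedSpace EG G] [Group G] [MulAction G M]
  [ContMDiffSMul 𝓘(ℝ, EG) 𝓘(ℝ, EM) ∞ G M]

theorem exists_smul_param_eq {Y D : Type*} [Group D] [MulAction D Y] {φ : G →* D}
    {f : M → Y} {x : M} {W : Type*} [NormedAddCommGroup W] [NormedSpace ℝ W]
    {K : Submodule ℝ EM} {N : Submodule ℝ EG} [CompleteSpace (N × W)] (κ : FibreChart f x K)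
    (η : FibreChart (fun g : G => φ g • f x) 1 N) (hequiv : ∀ (g : G) x, f (g • x) = φ g • f x)
    {L : W →L[ℝ] K} (e : (N × W) ≃L[ℝ] K)
    (he : K.subtypeL ∘L (e : N × W →L[ℝ] K) =
      ((infAction EG G EM x : EG →L[ℝ] EM) ∘L N.subtypeL).coprod (K.subtypeL ∘L L)) :
    ∃ s : M → N × W, SmoothNear 𝓘(ℝ, EM) 𝓘(ℝ, N × W) s x ∧ s x = 0 ∧
      ∀ᶠ z in 𝓝 x, f z = f x → η.param (s z).1 • κ.param (L (s z).2) = z := by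
  have hτ : SmoothNear 𝓘(ℝ, W) 𝓘(ℝ, EM) (fun c => κ.param (L c)) 0 :=
    κ.smoothNear_param.comp (smoothNear_clm L 0) (map_zero L)
  have hτ' := hasMFDerivAt_comp κ.hasMFDerivAt_param (L.hasMFDerivAt (x := 0)) (map_zero L)
  have hτ0 : κ.param (L 0) = x := by rw [map_zero, κ.param_zero]
  have hΨ' := hasMFDerivAt_smul_prod η.smoothNear_param hτ η.hasMFDerivAt_param hτ'
    η.param_zero hτ0
  refine κ.exists_coord (Ψ := fun p => η.param p.1 • κ.param (L p.2)) e ?_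
    (η.smoothNear_param.smul_prod hτ)
    (hΨ'.congr_mfderiv he.symm) ?_
  · rw [Prod.fst_zero, Prod.snd_zero, η.param_zero, one_smul, hτ0]
  · filter_upwards [continuousAt_fst.eventually η.apply_param, continuousAt_snd.eventually
      ((smoothNear_clm L 0).tendsto (map_zero L) κ.apply_param)] with p hp1 hp2
    rw [hequiv, hp2, hp1, map_one, one_smul]

variable {ES : Type*} [NormedAddCommGroup ES] [NormedSpace ℝ ES]
  {Y : Type*} [TopologicalSpace Y] [ChartedSpace ES Y]
  {D : Type*} [Group D] [MulAction D Y] {φ : G →* D} {f : M → Y} {x : M} {d : ℕ}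

theorem mfderivKer_orbit_eq (hf : MDifferentiableAt 𝓘(ℝ, EM) 𝓘(ℝ, ES) f x)
    (hequiv : ∀ (g : G) x, f (g • x) = φ g • f x) :
    mfderivKer 𝓘(ℝ, EG) 𝓘(ℝ, ES) (fun g : G => φ g • f x) 1 =
      ((mfderiv 𝓘(ℝ, EM) 𝓘(ℝ, ES) f x : EM →L[ℝ] ES) ∘L
        (infAction EG G EM x : EG →L[ℝ] EM)).ker := by
  have hcomp := hasMFDerivAt_comp (E := EG) (E' := EM) (E'' := ES) hf.hasMFDerivAt
    (hasMFDerivAt_infAction (G := G) (EG := EG) x) (one_smul G x)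
  exact congrArg (fun T : EG →L[ℝ] ES => T.ker)
    (hcomp.congr_of_eventuallyEq (.of_forall fun g => (hequiv g x).symm)).mfderiv

variable [FiniteDimensional ℝ EM] [IsManifold 𝓘(ℝ, EM) ∞ M] [LieGroup 𝓘(ℝ, EG) ∞ G]

theorem exists_coord_smul_eq {W : Type*} [NormedAddCommGroup W] [NormedSpace ℝ W] {τ : W → M}
    {τ' : W →L[ℝ] EM} (hτ : SmoothNear 𝓘(ℝ, W) 𝓘(ℝ, EM) τ 0)
    (hτ' : HasMFDerivAt 𝓘(ℝ, W) 𝓘(ℝ, EM) τ 0 τ') (hτx : τ 0 = x)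
    (hinj : Injective ((infAction EG G EM x : EG →L[ℝ] EM).coprod τ')) :
    ∃ r : M → W, SmoothNear 𝓘(ℝ, EM) 𝓘(ℝ, W) r x ∧
      ∀ᶠ q in 𝓝 ((1 : G), (0 : W)), r (q.1 • τ q.2) = q.2 := by
  have : IsManifold 𝓘(ℝ, EG) ∞ G := LieGroup.toContMDiffMul.toIsManifold
  have hγ : SmoothNear 𝓘(ℝ, EG) 𝓘(ℝ, EG) (localParam (1 : G)) (0 : EG) := smoothNear_localParam 1
  have hΦ' := hasMFDerivAt_smul_prod hγ hτ (hasMFDerivAt_localParam 1) hτ' (localParam_zero 1) hτx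
  obtain ⟨ρ, hρ, hρΦ⟩ := exists_smooth_local_retraction (hγ.smul_prod hτ)
    (hΦ'.mfderiv.symm ▸ hinj)
  have hx : localParam (1 : G) (0 : EG) • τ 0 = x := by rw [localParam_zero, one_smul, hτx]
  rw [hx] at hρ
  refine ⟨fun z => (ρ z).2, (smoothNear_clm (.snd ℝ EG W) _).comp hρ rfl, ?_⟩
  have hcoord := (smoothNear_localCoord (E := EG) (1 : G)).tendsto (localCoord_self 1)
  rw [nhds_prod_eq] at hρΦ ⊢
  filter_upwards [(hcoord.prodMap tendsto_id).eventually hρΦ,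
    tendsto_fst.eventually (eventually_localParam_localCoord (E := EG) (1 : G))] with q hq hq1
  simp only [Prod.map, id, hq1] at hq
  rw [hq]

theorem nonempty_localSlice [FiniteDimensional ℝ EG] [FiniteDimensional ℝ ES]
    [IsManifold 𝓘(ℝ, ES) ∞ Y]
    (hD : ∀ a : D, ContMDiff 𝓘(ℝ, ES) 𝓘(ℝ, ES) ∞ (fun s : Y => a • s))
    (horb : ContMDiff 𝓘(ℝ, EG) 𝓘(ℝ, ES) ∞ (fun g : G => φ g • f x))
    (hf : SmoothNear 𝓘(ℝ, EM) 𝓘(ℝ, ES) f x) (hequiv : ∀ (g : G) x, f (g • x) = φ g • f x)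
    (hsurj : Surjective (mfderiv 𝓘(ℝ, EM) 𝓘(ℝ, ES) f x))
    (hinj : Injective (infAction EG G EM x))
    (hd : d = finrank ℝ EM - (finrank ℝ ES +
      finrank ℝ (mfderivKer 𝓘(ℝ, EG) 𝓘(ℝ, ES) (fun g : G => φ g • f x) 1))) :
    Nonempty (LocalSlice EM G f x d) := by
  obtain ⟨κ⟩ := nonempty_fibreChart_of_surjective hf hsurj
  obtain ⟨η⟩ := nonempty_isotropyChart hD horb
  obtain ⟨L, e, he, hL⟩ := exists_linear_slice (V := EG) (W := EM) (U := ES)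
    (mfderiv 𝓘(ℝ, EM) 𝓘(ℝ, ES) f x) hsurj (infAction EG G EM x) hinj
    (K := mfderivKer 𝓘(ℝ, EM) 𝓘(ℝ, ES) f x) rfl
    (mfderivKer_orbit_eq hf.mdifferentiableAt hequiv) hd
  have hτ : SmoothNear (𝓡 d) 𝓘(ℝ, EM) (fun c => κ.param (L c)) 0 :=
    κ.smoothNear_param.comp (smoothNear_clm L 0) (map_zero L)
  have hτ0 : κ.param (L 0) = x := by rw [map_zero, κ.param_zero]
  obtain ⟨r, hr, hrτ⟩ := exists_coord_smul_eq hτ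
    (hasMFDerivAt_comp κ.hasMFDerivAt_param (L.hasMFDerivAt (x := 0)) (map_zero L)) hτ0 hL
  obtain ⟨s, hs, hs0, hΨs⟩ := exists_smul_param_eq κ η hequiv e he
  have hs1 : Tendsto (fun z => (s z).1) (𝓝 x) (𝓝 0) :=
    continuousAt_fst.tendsto.comp (hs.tendsto hs0)
  have hshift : Tendsto (fun z => η.param (s z).1) (𝓝 x) (𝓝 1) :=
    (η.smoothNear_param.tendsto η.param_zero).comp hs1
  have hpair : Tendsto (fun z => (η.param (s z).1, (s z).2)) (𝓝 x) (𝓝 ((1 : G), 0)) :=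
    hshift.prodMk_nhds (continuousAt_snd.tendsto.comp (hs.tendsto hs0))
  refine ⟨⟨fun c => κ.param (L c), r, hτ0, hτ, hr,
    (smoothNear_clm L 0).tendsto (map_zero L) κ.apply_param, hrτ, fun U hU => ?_⟩⟩
  filter_upwards [hshift hU, hpair hrτ, hΨs] with z hzU hzr hzs hz
  have hrz : r z = (s z).2 := (congrArg r (hzs hz)).symm.trans hzr
  exact ⟨η.param (s z).1, hzU,
    (congrArg (fun c => η.param (s z).1 • κ.param (L c)) hrz).trans (hzs hz)⟩

end LocalSlice

namespace LocalSlice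

variable {EM : Type*} [NormedAddCommGroup EM] [NormedSpace ℝ EM]
  {M : Type*} [TopologicalSpace M] [ChartedSpace EM M]
  {G : Type*} [TopologicalSpace G] [Group G] [MulAction G M] {Y : Type*} {f : M → Y} {x : M} {d : ℕ}
  (s : LocalSlice EM G f x d)

theorem coord_param : ∀ᶠ c in 𝓝 0, s.coord (s.param c) = c := by
  filter_upwards [(Continuous.prodMk_right (1 : G)).continuousAt.eventually s.coord_smul_param]
    with c hc
  rwa [one_smul] at hc

theorem coord_self : s.coord x = 0 := by
  simpa only [s.param_zero] using s.coord_param.self_of_nhds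

end LocalSlice

theorem SmoothNear.exists_contMDiff_eventuallyEq {E : Type*} [NormedAddCommGroup E]
    [NormedSpace ℝ E] [FiniteDimensional ℝ E] {M : Type*} [TopologicalSpace M] [ChartedSpace E M]
    [IsManifold 𝓘(ℝ, E) ∞ M] [T2Space M] {x : M} {f : M → ℝ}
    (hf : SmoothNear 𝓘(ℝ, E) 𝓘(ℝ, ℝ) f x) :
    ∃ F : M → ℝ, ContMDiff 𝓘(ℝ, E) 𝓘(ℝ, ℝ) ∞ F ∧ ∀ᶠ z in 𝓝 x, F z = f z := by
  obtain ⟨b, -, hb⟩ := (SmoothBumpFunction.nhds_basis_tsupport (I := 𝓘(ℝ, E)) x).mem_iff.1 hf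
  refine ⟨fun z => b z • f z, contMDiff_of_tsupport fun z hz =>
    b.contMDiffAt.smul (hb (tsupport_smul_subset_left (⇑b) f hz)), ?_⟩
  filter_upwards [b.eventuallyEq_one] with z hz
  rw [hz, Pi.one_apply, one_smul]

namespace PoissonBracket

variable {A B : Type*} [CommRing A] [Algebra ℝ A] [CommRing B] [Algebra ℝ B]

/-- Transport of a Poisson bracket along an isomorphism of algebras. -/
noncomputable def transport (e : A ≃ₐ[ℝ] B) (br : PoissonBracket B) : PoissonBracket A where
  bracket := (br.bracket.compl₁₂ e.toLinearMap e.toLinearMap).compr₂ e.symm.toLinearMap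
  bracket_self f := by simp [br.bracket_self]
  jacobi f g h := by
    apply e.injective
    simpa using br.jacobi (e f) (e g) (e h)
  leibniz f g h := by
    apply e.injective
    simpa using br.leibniz (e f) (e g) (e h)

theorem transport_apply (e : A ≃ₐ[ℝ] B) (br : PoissonBracket B) (f g : A) :
    e ((transport e br).bracket f g) = br.bracket (e f) (e g) :=
  e.apply_symm_apply _

end PoissonBracket

namespace HamiltonianSpace

variable {ED : Type*} [NormedAddCommGroup ED] [NormedSpace ℝ ED]
  {D : Type*} [TopologicalSpace D] [ChartedSpace ED D] [Group D]
  {EG : Type*} [NormedAddCommGroup EG] [NormedSpace ℝ EG] [FiniteDimensional ℝ EG]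
  {G : Type*} [TopologicalSpace G] [ChartedSpace EG G] [Group G]
  {P : SplitManinPair ED D EG G}
  {ES : Type*} [NormedAddCommGroup ES] [NormedSpace ℝ ES] [ChartedSpace ES P.S]
  {EM : Type*} [NormedAddCommGroup EM] [NormedSpace ℝ EM]
  {M : Type*} [TopologicalSpace M] [ChartedSpace EM M] [MulAction G M]
  (H : HamiltonianSpace P ES EM M) {y : P.S}

section ToPreimage

open Classical in
/-- The point `x` of `M` as a point of `J⁻¹(𝒪)`, with the junk value `p` if it lies outside. -/
noncomputable def toPreimage (p : H.Preimage y) (x : M) : H.Preimage y :=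
  if h : ∃ g : G, P.incl g • y = H.J x then ⟨x, h⟩ else p

variable {H} {p : H.Preimage y}

theorem val_toPreimage {x : M} (hx : H.J x = y) : (H.toPreimage p x).1 = x :=
  congrArg Subtype.val (dif_pos ⟨1, by rw [map_one, one_smul, hx]⟩)

theorem continuousAt_toPreimage_comp {Z : Type*} [TopologicalSpace Z] {τ : Z → M} {c : Z}
    (hτ : ContinuousAt τ c) (hJ : ∀ᶠ c' in 𝓝 c, H.J (τ c') = y) :
    ContinuousAt (fun c => H.toPreimage p (τ c)) c := by
  refine H.tendsto_preimage_iff.2 ⟨?_, ?_⟩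
  · rw [val_toPreimage hJ.self_of_nhds]
    exact hτ.tendsto.congr' (hJ.mono fun c' h => (val_toPreimage h).symm)
  · refine tendsto_const_nhds.congr' (hJ.mono fun c' h => Subtype.ext ?_)
    change H.J (H.toPreimage p (τ c)).1 = H.J (H.toPreimage p (τ c')).1
    rw [val_toPreimage hJ.self_of_nhds, val_toPreimage h, hJ.self_of_nhds, h]

end ToPreimage

/-- The dimension of the reduced space `J⁻¹(𝒪) / G`, namely
`dim M - (dim S + dim 𝔤_y) = dim J⁻¹(𝒪) - dim 𝔤`. -/
noncomputable def reducedDim (_H : HamiltonianSpace P ES EM M) (y : P.S) : ℕ :=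
  finrank ℝ EM -
    (finrank ℝ ES + finrank ℝ (mfderivKer 𝓘(ℝ, EG) 𝓘(ℝ, ES) (fun g : G => P.incl g • y) 1))

/-- A slice to the orbits in `J⁻¹(𝒪)`, parametrized by an open subset of `ℝᵈ`, together with a
smooth map which recovers the parameter near the slice. -/
structure Slice (y : P.S) (d : ℕ) where
  dom : Set (EuclideanSpace ℝ (Fin d))
  dom_open : IsOpen dom
  point : EuclideanSpace ℝ (Fin d) → H.Preimage y
  coord : M → EuclideanSpace ℝ (Fin d)
  smooth_point : ∀ c ∈ dom, ContMDiffAt (𝓡 d) 𝓘(ℝ, EM) ∞ (fun c => (point c).1) c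
  continuousAt_point : ∀ c ∈ dom, ContinuousAt point c
  smooth_coord : ∀ c ∈ dom, SmoothNear 𝓘(ℝ, EM) (𝓡 d) coord (point c).1
  injective : ∀ c ∈ dom, ∀ c' ∈ dom, ∀ g : G, g • point c = point c' → c = c'
  coord_point : ∀ c ∈ dom, coord (point c).1 = c
  eventually_mem : ∀ c ∈ dom, ∀ᶠ q in 𝓝 (point c), ∃ g : G, g • point (coord q.1) = q

theorem eventually_mem_of_smul_eq {G X : Type*} [TopologicalSpace G] [Group G] [TopologicalSpace X]
    [MulAction G X] [ProperSMul G X] {p : X} (hfree : ∀ g : G, g • p = p → g = 1) {W : Set G}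
    (hW : W ∈ 𝓝 (1 : G)) : ∀ᶠ q in 𝓝 (p, p), ∀ g : G, g • q.2 = q.1 → g ∈ W := by
  have hclosed : IsClosed ((fun q : G × X => (q.1 • q.2, q.2)) '' ((interior W)ᶜ ×ˢ Set.univ)) :=
    ProperSMul.isProperMap_smul_pair.isClosedMap _
      (isOpen_interior.isClosed_compl.prod isClosed_univ)
  have hp : (p, p) ∉ (fun q : G × X => (q.1 • q.2, q.2)) '' ((interior W)ᶜ ×ˢ Set.univ) := by
    rintro ⟨⟨g, q⟩, ⟨hg, -⟩, h⟩
    obtain ⟨hgq, rfl⟩ := Prod.mk.inj h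
    exact hg (hfree g hgq ▸ mem_interior_iff_mem_nhds.2 hW)
  filter_upwards [hclosed.isOpen_compl.mem_nhds hp] with q hq g hg
  by_contra hgW
  exact hq ⟨(g, q.2), ⟨fun h => hgW (interior_subset h), trivial⟩, Prod.ext hg rfl⟩

section LocalSlice

variable {H} {p : H.Preimage y} {d : ℕ} (s : LocalSlice EM G H.J p.1 d)

theorem tendsto_toPreimage_param (hp : H.J p.1 = y) :
    Tendsto (fun c => H.toPreimage p (s.param c)) (𝓝 0) (𝓝 p) := by
  have hself : H.toPreimage p (s.param 0) = p := Subtype.ext <| by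
    rw [s.param_zero, val_toPreimage hp]
  have hcont : ContinuousAt (fun c => H.toPreimage p (s.param c)) 0 :=
    continuousAt_toPreimage_comp s.smoothNear_param.continuousAt
      (s.apply_param.mono fun _ h => h.trans hp)
  simpa only [hself] using hcont.tendsto

theorem eventually_eq_of_smul_toPreimage_eq [ProperSMul G (H.Preimage y)] (hp : H.J p.1 = y)
    (hfree : ∀ g : G, g • p = p → g = 1) :
    ∀ᶠ c in 𝓝 0 ×ˢ 𝓝 0, ∀ g : G,
      g • H.toPreimage p (s.param c.2) = H.toPreimage p (s.param c.1) → c.2 = c.1 := by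
  have hcoord := s.coord_smul_param
  rw [nhds_prod_eq] at hcoord
  obtain ⟨A, hA, B, hB, hAB⟩ := eventually_prod_iff.1 hcoord
  have hpoint := tendsto_toPreimage_param s hp
  have hA' := eventually_mem_of_smul_eq hfree hA
  rw [nhds_prod_eq] at hA'
  have hgood := hB.and (s.apply_param.and s.coord_param)
  filter_upwards [(hpoint.prodMap hpoint).eventually hA', hgood.prod_mk hgood]
    with c hc ⟨⟨_, hJ₁, hcoord₁⟩, hB₂, hJ₂, _⟩ g hg
  have hval : g • s.param c.2 = s.param c.1 := by
    have := congrArg Subtype.val hg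
    rwa [val_smul, val_toPreimage (hJ₂.trans hp), val_toPreimage (hJ₁.trans hp)] at this
  calc c.2 = s.coord (g • s.param c.2) := (hAB (hc g hg) hB₂).symm
    _ = c.1 := by rw [hval, hcoord₁]

variable [LieGroup 𝓘(ℝ, EG) ∞ G] [ContMDiffSMul 𝓘(ℝ, EG) 𝓘(ℝ, EM) ∞ G M]

theorem eventually_exists_smul_param_coord (hp : H.J p.1 = y) :
    ∀ᶠ q in 𝓝 p, ∃ g : G, g • s.param (s.coord q.1) = q.1 := by
  have := topologicalGroup_of_lieGroup 𝓘(ℝ, EG) (G := G) ∞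
  have : ContinuousSMul G M := ContMDiffSMul.continuousSMul (I := 𝓘(ℝ, EG)) (I' := 𝓘(ℝ, EM)) ∞
  have hcoord := s.coord_smul_param
  rw [nhds_prod_eq] at hcoord
  obtain ⟨A, hA, B, hB, hAB⟩ := eventually_prod_iff.1 hcoord
  obtain ⟨U, hU, hUA⟩ := exists_nhds_one_split hA
  have hshift : Tendsto (fun r : G × M => r.1⁻¹ • r.2) (𝓝 (1, p.1)) (𝓝 p.1) :=
    (continuous_fst.inv.smul continuous_snd).tendsto' _ _
      ((congrArg (· • p.1) inv_one).trans (one_smul G p.1))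
  have hnear : ∀ᶠ r : G × M in 𝓝 (1, p.1), r.1 ∈ U ∧ B (s.coord (r.1⁻¹ • r.2)) ∧
      (H.J (r.1⁻¹ • r.2) = H.J p.1 →
        ∃ g ∈ U, g • s.param (s.coord (r.1⁻¹ • r.2)) = r.1⁻¹ • r.2) := by
    filter_upwards [continuousAt_fst.eventually hU,
      hshift.eventually (s.smoothNear_coord.tendsto s.coord_self hB),
      hshift.eventually (s.exists_smul_param_coord U hU)] with r hr hB hg using ⟨hr, hB, hg⟩
  filter_upwards [H.eventually_exists_incl_smul_eq hp hnear] with q ⟨h, hhJ, hhU, hhB, hfibre⟩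
  obtain ⟨g, hgU, hg⟩ := hfibre (by rw [H.J_equivariant, ← hhJ, map_inv, inv_smul_smul, hp])
  have hq : (h * g) • s.param (s.coord (h⁻¹ • q.1)) = q.1 := by rw [mul_smul, hg, smul_inv_smul]
  have hcoord_eq : s.coord q.1 = s.coord (h⁻¹ • q.1) :=
    (congrArg s.coord hq).symm.trans (hAB (hUA h hhU g hgU) hhB)
  exact ⟨h * g, by rw [hcoord_eq, hq]⟩

theorem eventually_exists_smul_toPreimage_coord (hp : H.J p.1 = y) :
    ∀ᶠ q in 𝓝 p, ∃ g : G, g • H.toPreimage p (s.param (s.coord q.1)) = q := by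
  have hcoord : Tendsto (fun q : H.Preimage y => s.coord q.1) (𝓝 p) (𝓝 0) :=
    (s.smoothNear_coord.tendsto s.coord_self).comp H.continuous_val.continuousAt
  filter_upwards [eventually_exists_smul_param_coord s hp, hcoord s.apply_param]
    with q ⟨g, hg⟩ hJ
  exact ⟨g, Subtype.ext (by rwa [val_smul, val_toPreimage (hJ.trans hp)])⟩

end LocalSlice

section Slice

variable [LieGroup 𝓘(ℝ, EG) ∞ G] [ContMDiffSMul 𝓘(ℝ, EG) 𝓘(ℝ, EM) ∞ G M]
  [IsManifold 𝓘(ℝ, EM) ∞ M] {H}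

theorem injective_infAction (q : H.Preimage y) (hfree : ∀ g : G, g • q = q → g = 1) :
    Injective (infAction EG G EM q.1) :=
  injective_mfderiv_of_trivial_isotropy (φ := MonoidHom.id G)
    (ContMDiffSMul.contMDiff_const_smul (I := 𝓘(ℝ, EG))) (contMDiff_orbit q.1)
    fun g hg => hfree g (Subtype.ext hg)

theorem exists_slice [FiniteDimensional ℝ EM] [FiniteDimensional ℝ ES] [IsManifold 𝓘(ℝ, ES) ∞ P.S]
    [ProperSMul G (H.Preimage y)]
    (hdress : ∀ a : D, ContMDiff 𝓘(ℝ, ES) 𝓘(ℝ, ES) ∞ (fun s : P.S => a • s))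
    (horb : ContMDiff 𝓘(ℝ, EG) 𝓘(ℝ, ES) ∞ (fun g : G => P.incl g • y)) {p : H.Preimage y}
    (hreg : Surjective (mfderiv 𝓘(ℝ, EM) 𝓘(ℝ, ES) H.J p.1)) (hfree : ∀ g : G, g • p = p → g = 1)
    (hp : H.J p.1 = y) :
    ∃ s : H.Slice y (H.reducedDim y), 0 ∈ s.dom ∧ s.point 0 = p := by
  obtain ⟨s⟩ := nonempty_localSlice (φ := P.incl) (f := H.J) hdress (by rwa [hp])
    (smoothNear_of_contMDiff H.J_smooth p.1) H.J_equivariant hreg (injective_infAction p hfree)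
    (d := H.reducedDim y) (by rw [hp]; rfl)
  have hJ : ∀ᶠ c in 𝓝 0, H.J (s.param c) = y := s.apply_param.mono fun _ h => h.trans hp
  have hpoint := tendsto_toPreimage_param s hp
  have hcoord : ∀ᶠ c in 𝓝 0, SmoothNear 𝓘(ℝ, EM) (𝓡 _) s.coord (s.param c) :=
    s.smoothNear_param.tendsto s.param_zero (eventually_eventually_nhds.2 s.smoothNear_coord)
  have hmem := hpoint.eventually
    (eventually_eventually_nhds.2 (eventually_exists_smul_toPreimage_coord s hp))
  have hgood := s.smoothNear_param.and <| (eventually_eventually_nhds.2 hJ).and <|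
    hcoord.and <| s.coord_param.and hmem
  obtain ⟨A, hA, hAinj⟩ :=
    eventually_prod_self_iff'.1 (eventually_eq_of_smul_toPreimage_eq s hp hfree)
  obtain ⟨U, hU, hUo, hU0⟩ := eventually_nhds_iff.1 (hgood.and hA)
  have hval : ∀ c ∈ U, (H.toPreimage p (s.param c)).1 = s.param c := fun c hc =>
    val_toPreimage (hU c hc).1.2.1.self_of_nhds
  refine ⟨⟨U, hUo, fun c => H.toPreimage p (s.param c), s.coord, fun c hc => ?_, fun c hc => ?_,
    fun c hc => ?_, fun c hc c' hc' g hg => ?_, fun c hc => ?_, fun c hc => ?_⟩, hU0,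
    Subtype.ext (by rw [hval 0 hU0, s.param_zero])⟩
  · exact (hU c hc).1.1.congr_of_eventuallyEq ((hU c hc).1.2.1.mono fun c' h => val_toPreimage h)
  · exact continuousAt_toPreimage_comp (hU c hc).1.1.continuousAt (hU c hc).1.2.1
  · rw [hval c hc]
    exact (hU c hc).1.2.2.1
  · exact hAinj c' (hU c' hc').2 c (hU c hc).2 g hg
  · rw [hval c hc]
    exact (hU c hc).1.2.2.2.1
  · exact (hU c hc).1.2.2.2.2

end Slice

/-! ### The reduced space -/

variable {H} {d : ℕ}

section Projection

theorem proj_surjective : Surjective (H.proj (y := y)) := Quotient.mk_surjective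

theorem proj_eq_proj_iff {p q : H.Preimage y} : H.proj p = H.proj q ↔ ∃ g : G, g • q = p :=
  Quotient.eq.trans Iff.rfl

theorem proj_smul (g : G) (p : H.Preimage y) : H.proj (g • p) = H.proj p :=
  proj_eq_proj_iff.2 ⟨g, rfl⟩

theorem exists_proj_eq_of_fibre (q : H.ReducedSpace y) :
    ∃ p : H.Preimage y, H.J p.1 = y ∧ H.proj p = q := by
  obtain ⟨p, rfl⟩ := proj_surjective q
  obtain ⟨g, hg⟩ := p.2
  refine ⟨g⁻¹ • p, ?_, proj_smul g⁻¹ p⟩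
  rw [val_smul, H.J_equivariant, ← hg, map_inv, inv_smul_smul]

theorem isOpenQuotientMap_proj [ContinuousConstSMul G (H.Preimage y)] :
    IsOpenQuotientMap (H.proj (y := y)) :=
  MulAction.isOpenQuotientMap_quotientMk

theorem continuous_proj : Continuous (H.proj (y := y)) := continuous_quotient_mk'

variable (H y) in
theorem lindelofSpace_reducedSpace [SecondCountableTopology M] :
    LindelofSpace (H.ReducedSpace y) := by
  let ι : {x : M // H.J x = y} → H.Preimage y := fun x =>
    ⟨x.1, 1, by rw [x.2, map_one, one_smul]⟩
  have hι : Continuous ι := continuous_iff_continuousAt.2 fun x => H.tendsto_preimage_iff.2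
    ⟨continuous_subtype_val.continuousAt,
      tendsto_const_nhds.congr fun z => Subtype.ext (x.2.trans z.2.symm)⟩
  have hrange : Set.range (H.proj ∘ ι) = Set.univ := Set.eq_univ_of_forall fun q => by
    obtain ⟨p, hp, hpq⟩ := exists_proj_eq_of_fibre q
    exact ⟨⟨p.1, hp⟩, hpq⟩
  rw [← isLindelof_univ_iff, ← hrange]
  exact isLindelof_range (continuous_proj.comp hι)

end Projection

namespace Slice

variable [ContinuousConstSMul G (H.Preimage y)]

theorem image_mem_nhds (s : H.Slice y d) {c : EuclideanSpace ℝ (Fin d)} (hc : c ∈ s.dom)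
    {B : Set (EuclideanSpace ℝ (Fin d))} (hB : B ∈ 𝓝 c) :
    (fun c => H.proj (s.point c)) '' B ∈ 𝓝 (H.proj (s.point c)) := by
  rw [← isOpenQuotientMap_proj.map_nhds_eq, mem_map]
  have hcoord : Tendsto (fun q : H.Preimage y => s.coord q.1) (𝓝 (s.point c)) (𝓝 c) :=
    ((s.smooth_coord c hc).tendsto (s.coord_point c hc)).comp H.continuous_val.continuousAt
  filter_upwards [s.eventually_mem c hc, hcoord hB] with q ⟨g, hg⟩ hqB
  exact ⟨s.coord q.1, hqB, (proj_smul g _).symm.trans (congrArg H.proj hg)⟩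

omit [ContinuousConstSMul G (H.Preimage y)] in
theorem injOn_proj (s : H.Slice y d) : Set.InjOn (fun c => H.proj (s.point c)) s.dom := by
  intro c hc c' hc' h
  obtain ⟨g, hg⟩ := proj_eq_proj_iff.1 h
  exact (s.injective c' hc' c hc g hg).symm

theorem isOpenMap_domRestrict_proj (s : H.Slice y d) :
    IsOpenMap (s.dom.domRestrict fun c => H.proj (s.point c)) := by
  refine isOpenMap_iff_nhds_le.2 fun ⟨c, hc⟩ A hA => ?_
  have himage := (s.dom_open.isOpenEmbedding_subtypeVal.image_mem_nhds (x := ⟨c, hc⟩)).2 hA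
  refine mem_of_superset (s.image_mem_nhds hc himage) ?_
  rintro _ ⟨_, ⟨c', hc', rfl⟩, rfl⟩
  exact hc'

/-- The local parametrization of the reduced space given by a slice. -/
noncomputable def param (s : H.Slice y d) :
    OpenPartialHomeomorph (EuclideanSpace ℝ (Fin d)) (H.ReducedSpace y) :=
  OpenPartialHomeomorph.ofContinuousOpenRestrict s.injOn_proj.toPartialEquiv
    (fun c hc => (continuous_proj.continuousAt.comp
      (s.continuousAt_point c hc)).continuousWithinAt)
    s.isOpenMap_domRestrict_proj s.dom_open

theorem param_apply (s : H.Slice y d) (c) : s.param c = H.proj (s.point c) := rfl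

theorem exists_smooth_lift [LieGroup 𝓘(ℝ, EG) ∞ G] [ContMDiffSMul 𝓘(ℝ, EG) 𝓘(ℝ, EM) ∞ G M]
    (s : H.Slice y d) {p : H.Preimage y} (hp : H.proj p ∈ s.param.target) :
    ∃ R : M → EuclideanSpace ℝ (Fin d), SmoothNear 𝓘(ℝ, EM) (𝓡 d) R p.1 ∧
      ∀ᶠ q in 𝓝 p, s.param.symm (H.proj q) = R q.1 := by
  obtain ⟨c, hc, hcp⟩ : ∃ c ∈ s.dom, H.proj (s.point c) = H.proj p :=
    ⟨_, s.param.map_target hp, s.param.right_inv hp⟩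
  obtain ⟨g, hg⟩ := proj_eq_proj_iff.1 hcp
  have hsmul : ContMDiff 𝓘(ℝ, EM) 𝓘(ℝ, EM) ∞ (fun z : M => g • z) :=
    ContMDiffSMul.contMDiff_const_smul (I := 𝓘(ℝ, EG)) g
  refine ⟨fun z => s.coord (g • z), (s.smooth_coord c hc).comp
    (smoothNear_of_contMDiff hsmul p.1) (congrArg Subtype.val hg), ?_⟩
  have hshift : Tendsto (fun q : H.Preimage y => g • q) (𝓝 p) (𝓝 (s.point c)) :=
    hg ▸ (continuous_const_smul g).continuousAt
  have hcoord : Tendsto (fun q : H.Preimage y => s.coord q.1) (𝓝 (s.point c)) (𝓝 c) :=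
    ((s.smooth_coord c hc).tendsto (s.coord_point c hc)).comp H.continuous_val.continuousAt
  filter_upwards [hshift.eventually (s.eventually_mem c hc),
    hshift.eventually (hcoord (s.dom_open.mem_nhds hc))] with q ⟨g', hg'⟩ hq
  have hproj : H.proj q = s.param (s.coord (g • q).1) := by
    rw [param_apply, ← proj_smul g' (s.point _), hg', proj_smul]
  rw [hproj]
  exact s.param.left_inv hq

theorem contDiffOn_transition [LieGroup 𝓘(ℝ, EG) ∞ G] [ContMDiffSMul 𝓘(ℝ, EG) 𝓘(ℝ, EM) ∞ G M]
    (s s' : H.Slice y d) :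
    ContDiffOn ℝ ∞ (s.param ≫ₕ s'.param.symm) (s.param ≫ₕ s'.param.symm).source := by
  rintro c ⟨hc, hc'⟩
  obtain ⟨R, hR, hRs⟩ := s'.exists_smooth_lift (p := s.point c) hc'
  have hRpoint : ContMDiffAt (𝓡 d) (𝓡 d) ∞ (fun c => R (s.point c).1) c :=
    ContMDiffAt.comp c hR.contMDiffAt (s.smooth_point c hc)
  refine (contMDiffAt_iff_contDiffAt.1 (hRpoint.congr_of_eventuallyEq ?_)).contDiffWithinAt
  exact (s.continuousAt_point c hc).tendsto.eventually hRs

end Slice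

section Atlas

variable [ContinuousConstSMul G (H.Preimage y)]
  (hs : ∀ q : H.ReducedSpace y, ∃ s : H.Slice y d, q ∈ s.param.target)

/-- The atlas of the reduced space given by a family of slices. -/
@[reducible] noncomputable def reducedChartedSpace :
    ChartedSpace (EuclideanSpace ℝ (Fin d)) (H.ReducedSpace y) where
  atlas := Set.range fun q => (hs q).choose.param.symm
  chartAt q := (hs q).choose.param.symm
  mem_chart_source q := (hs q).choose_spec
  chart_mem_atlas q := ⟨q, rfl⟩

include hs in
theorem secondCountable_reducedSpace [SecondCountableTopology M] :
    SecondCountableTopology (H.ReducedSpace y) := by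
  let := reducedChartedSpace hs
  have := H.lindelofSpace_reducedSpace y
  obtain ⟨t, htc, ht⟩ := countable_cover_nhds fun q : H.ReducedSpace y =>
    chart_source_mem_nhds (EuclideanSpace ℝ (Fin d)) q
  exact ChartedSpace.secondCountable_of_countable_cover _ ht htc

variable [LieGroup 𝓘(ℝ, EG) ∞ G] [ContMDiffSMul 𝓘(ℝ, EG) 𝓘(ℝ, EM) ∞ G M]

theorem isManifold_reducedSpace :
    letI := reducedChartedSpace hs
    IsManifold (𝓡 d) ∞ (H.ReducedSpace y) := by
  let := reducedChartedSpace hs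
  refine isManifold_of_contDiffOn _ _ _ ?_
  rintro _ _ ⟨q, rfl⟩ ⟨q', rfl⟩
  simpa using (hs q).choose.contDiffOn_transition (hs q').choose

theorem isSmooth_comp_proj [FiniteDimensional ℝ EM] [IsManifold 𝓘(ℝ, EM) ∞ M] [T2Space M]
    {h : H.ReducedSpace y → ℝ} :
    letI := reducedChartedSpace hs
    ContMDiff (𝓡 d) 𝓘(ℝ, ℝ) ∞ h → IsSmooth (fun p : H.Preimage y => h (H.proj p)) := by
  let := reducedChartedSpace hs
  have := isManifold_reducedSpace hs
  intro hh p
  let e := chartAt (EuclideanSpace ℝ (Fin d)) (H.proj p)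
  have hsource : H.proj p ∈ e.source := mem_chart_source _ _
  obtain ⟨R, hR, hRs⟩ := (hs (H.proj p)).choose.exists_smooth_lift (hs (H.proj p)).choose_spec
  have hRp : R p.1 = e (H.proj p) := hRs.self_of_nhds.symm
  have hsymm : SmoothNear (𝓡 d) (𝓡 d) e.symm (e (H.proj p)) := by
    filter_upwards [e.open_target.mem_nhds (e.map_source hsource)] with c hc
    exact contMDiffAt_symm_of_mem_maximalAtlas (IsManifold.chart_mem_maximalAtlas _) hc
  obtain ⟨F, hF, hFR⟩ := ((smoothNear_of_contMDiff hh _).comp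
    (hsymm.comp hR hRp) rfl).exists_contMDiff_eventuallyEq
  refine ⟨F, hF, ?_⟩
  filter_upwards [H.continuous_val.continuousAt.eventually hFR, hRs,
    continuous_proj.continuousAt.eventually (e.open_source.mem_nhds hsource)] with q hFq hRq hq
  rw [hFq, ← hRq]
  exact congrArg h (e.left_inv hq)

theorem contMDiff_of_isSmooth_comp_proj {h : H.ReducedSpace y → ℝ}
    (hh : IsSmooth (fun p : H.Preimage y => h (H.proj p))) :
    letI := reducedChartedSpace hs
    ContMDiff (𝓡 d) 𝓘(ℝ, ℝ) ∞ h := by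
  let := reducedChartedSpace hs
  have := isManifold_reducedSpace hs
  intro q
  let s := (hs q).choose
  have hq : q ∈ s.param.target := (hs q).choose_spec
  have hc : s.param.symm q ∈ s.dom := s.param.map_target hq
  obtain ⟨F, hF, hFh⟩ := hh (s.point (s.param.symm q))
  have hparam : ContMDiffAt (𝓡 d) 𝓘(ℝ, ℝ) ∞ (fun c => h (s.param c)) (s.param.symm q) :=
    ((hF _).comp _ (s.smooth_point _ hc)).congr_of_eventuallyEq
      (((s.continuousAt_point _ hc).tendsto.eventually hFh).mono fun _ => Eq.symm)
  have hsymm : ContMDiffAt (𝓡 d) (𝓡 d) ∞ s.param.symm q := contMDiffAt_of_mem_maximalAtlas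
    (IsManifold.subset_maximalAtlas (show s.param.symm ∈ atlas _ _ from ⟨q, rfl⟩)) hq
  refine (ContMDiffAt.comp q hparam hsymm).congr_of_eventuallyEq ?_
  filter_upwards [s.param.open_target.mem_nhds hq] with q' hq'
  exact congrArg h (s.param.right_inv hq').symm

theorem contMDiff_iff_isSmooth [FiniteDimensional ℝ EM] [IsManifold 𝓘(ℝ, EM) ∞ M] [T2Space M]
    (h : H.ReducedSpace y → ℝ) :
    letI := reducedChartedSpace hs
    ContMDiff (𝓡 d) 𝓘(ℝ, ℝ) ∞ h ↔ IsSmooth (fun p : H.Preimage y => h (H.proj p)) :=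
  ⟨isSmooth_comp_proj hs, contMDiff_of_isSmooth_comp_proj hs⟩

end Atlas

section PoissonStructure

variable [ChartedSpace (EuclideanSpace ℝ (Fin d)) (H.ReducedSpace y)]
  (hsmooth : ∀ h : H.ReducedSpace y → ℝ, ContMDiff (𝓡 d) 𝓘(ℝ, ℝ) ∞ h ↔
    IsSmooth (fun p : H.Preimage y => h (H.proj p)))

/-- The pull-back isomorphism of `C^∞(J⁻¹(𝒪) / G)` with `C^∞(J⁻¹(𝒪))^G`. -/
noncomputable def pullbackEquiv :
    C^∞⟮𝓡 d, H.ReducedSpace y; ℝ⟯ ≃ₐ[ℝ] H.invariantFunctions y where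
  toFun h := ⟨fun p => h (H.proj p), (hsmooth h).1 h.contMDiff,
    fun g p => congrArg h (proj_smul g p)⟩
  invFun f :=
    ⟨Quotient.lift f.1 fun a b hab => by
      obtain ⟨g, rfl⟩ := (MulAction.orbitRel_apply (G := G)).1 hab
      exact f.2.2 g b, (hsmooth _).2 f.2.1⟩
  left_inv h := by
    ext q
    obtain ⟨p, rfl⟩ := proj_surjective q
    rfl
  right_inv f := rfl
  map_mul' h k := rfl
  map_add' h k := rfl
  commutes' r := rfl

include hsmooth in
theorem existsUnique_reducedPoisson (br : PoissonBracket (H.invariantFunctions y)) :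
    ∃! brQ : PoissonBracket C^∞⟮𝓡 d, H.ReducedSpace y; ℝ⟯,
      ∀ (h k : C^∞⟮𝓡 d, H.ReducedSpace y; ℝ⟯) (f g : H.invariantFunctions y),
        (∀ p, f.1 p = h (H.proj p)) → (∀ p, g.1 p = k (H.proj p)) →
        ∀ p, brQ.bracket h k (H.proj p) = (br.bracket f g).1 p := by
  refine ⟨PoissonBracket.transport (pullbackEquiv hsmooth) br, ?_, ?_⟩
  · intro h k f g hf hg p
    obtain rfl : f = pullbackEquiv hsmooth h := Subtype.ext (funext hf)
    obtain rfl : g = pullbackEquiv hsmooth k := Subtype.ext (funext hg)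
    rw [← PoissonBracket.transport_apply]
    rfl
  · intro br' hbr'
    ext h k q
    obtain ⟨p, rfl⟩ := proj_surjective q
    rw [hbr' h k (pullbackEquiv hsmooth h) (pullbackEquiv hsmooth k) (fun _ => rfl)
      (fun _ => rfl) p, ← PoissonBracket.transport_apply]
    rfl

end PoissonStructure

theorem exists_slice_of_reducedSpace [LieGroup 𝓘(ℝ, EG) ∞ G] [FiniteDimensional ℝ ES]
    [IsManifold 𝓘(ℝ, ES) ∞ P.S] [FiniteDimensional ℝ EM] [IsManifold 𝓘(ℝ, EM) ∞ M]
    [ContMDiffSMul 𝓘(ℝ, EG) 𝓘(ℝ, EM) ∞ G M] [ProperSMul G (H.Preimage y)]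
    (hdress : ∀ a : D, ContMDiff 𝓘(ℝ, ES) 𝓘(ℝ, ES) ∞ (fun s : P.S => a • s))
    (horb : ContMDiff 𝓘(ℝ, EG) 𝓘(ℝ, ES) ∞ (fun g : G => P.incl g • y))
    (hreg : ∀ q : H.Preimage y, Surjective (mfderiv 𝓘(ℝ, EM) 𝓘(ℝ, ES) H.J q.1))
    (hfree : ∀ (g : G) (p : H.Preimage y), g • p = p → g = 1) (q : H.ReducedSpace y) :
    ∃ s : H.Slice y (H.reducedDim y), q ∈ s.param.target := by
  obtain ⟨p, hp, rfl⟩ := exists_proj_eq_of_fibre q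
  obtain ⟨s, hs, rfl⟩ := exists_slice hdress horb (hreg p) (fun g => hfree g p) hp
  exact ⟨s, s.param.map_source hs⟩

end HamiltonianSpace

end QuasiPoisson

theorem proposition4p15_general
    {ED : Type*} [NormedAddCommGroup ED] [NormedSpace ℝ ED] [FiniteDimensional ℝ ED]
    {D : Type*} [TopologicalSpace D] [ChartedSpace ED D] [Group D] [LieGroup 𝓘(ℝ, ED) ∞ D]
    {EG : Type*} [NormedAddCommGroup EG] [NormedSpace ℝ EG] [FiniteDimensional ℝ EG]
    {G : Type*} [TopologicalSpace G] [ChartedSpace EG G] [Group G] [LieGroup 𝓘(ℝ, EG) ∞ G]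
    [ConnectedSpace G]
    (P : QuasiPoisson.SplitManinPair ED D EG G)
    -- the smooth structure of `S = D / G`: the one for which `D → D / G` is a submersion
    {ES : Type*} [NormedAddCommGroup ES] [NormedSpace ℝ ES] [FiniteDimensional ℝ ES]
    [ChartedSpace ES P.S] [IsManifold 𝓘(ℝ, ES) ∞ P.S]
    (hS_smooth : ContMDiff 𝓘(ℝ, ED) 𝓘(ℝ, ES) ∞ (fun a : D => (a : P.S)))
    (hS_submersion : ∀ a : D,
      Function.Surjective (mfderiv 𝓘(ℝ, ED) 𝓘(ℝ, ES) (fun a : D => (a : P.S)) a))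
    {EM : Type*} [NormedAddCommGroup EM] [NormedSpace ℝ EM] [FiniteDimensional ℝ EM]
    {M : Type*} [TopologicalSpace M] [ChartedSpace EM M] [IsManifold 𝓘(ℝ, EM) ∞ M]
    [T2Space M] [SecondCountableTopology M]
    [MulAction G M] [ContMDiffSMul 𝓘(ℝ, EG) 𝓘(ℝ, EM) ∞ G M]
    (H : QuasiPoisson.HamiltonianSpace P ES EM M)
    (y : P.S) (hy : H.IsRegularValue y) :
    ∃ br : QuasiPoisson.PoissonBracket (H.invariantFunctions y),
      H.IsReducedBracket br ∧
      (∀ br' : QuasiPoisson.PoissonBracket (H.invariantFunctions y),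
        H.IsReducedBracket br' → br' = br) ∧
      -- if `G` acts freely and properly on `J⁻¹(𝒪)`, then `J⁻¹(𝒪) / G` is a Poisson manifold
      ((∀ (g : G) (p : H.Preimage y), g • p = p → g = 1) → ProperSMul G (H.Preimage y) →
        ∃ (d : ℕ) (_ : ChartedSpace (EuclideanSpace ℝ (Fin d)) (H.ReducedSpace y)),
          IsManifold (𝓡 d) ∞ (H.ReducedSpace y) ∧
          T2Space (H.ReducedSpace y) ∧ SecondCountableTopology (H.ReducedSpace y) ∧
          (∀ h : H.ReducedSpace y → ℝ,
            ContMDiff (𝓡 d) 𝓘(ℝ, ℝ) ∞ h ↔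
              QuasiPoisson.HamiltonianSpace.IsSmooth (fun p : H.Preimage y => h (H.proj p))) ∧
          ∃! brQ : QuasiPoisson.PoissonBracket C^∞⟮𝓡 d, H.ReducedSpace y; ℝ⟯,
            ∀ (h k : C^∞⟮𝓡 d, H.ReducedSpace y; ℝ⟯) (f g : H.invariantFunctions y),
              (∀ p, f.1 p = h (H.proj p)) → (∀ p, g.1 p = k (H.proj p)) →
              ∀ p, brQ.bracket h k (H.proj p) = (br.bracket f g).1 p) := by
  have hdress := QuasiPoisson.contMDiff_smul_coset hS_smooth hS_submersion
  have horb := P.contMDiff_orbitMap hS_smooth y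
  have hreg := hy.surjective_mfderiv hdress
  have hbracket := QuasiPoisson.HamiltonianSpace.isReducedBracket_reducedBracket hreg
  refine ⟨_, hbracket, fun _ hbr => hbracket.unique hbr, fun hfree _ => ?_⟩
  have hslice :=
    QuasiPoisson.HamiltonianSpace.exists_slice_of_reducedSpace hdress horb hreg hfree
  have hsmooth := QuasiPoisson.HamiltonianSpace.contMDiff_iff_isSmooth hslice
  let := QuasiPoisson.HamiltonianSpace.reducedChartedSpace hslice
  exact ⟨H.reducedDim y, this, QuasiPoisson.HamiltonianSpace.isManifold_reducedSpace hslice,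
    t2Space_quotient_mulAction_of_properSMul,
    QuasiPoisson.HamiltonianSpace.secondCountable_reducedSpace hslice, hsmooth,
    QuasiPoisson.HamiltonianSpace.existsUnique_reducedPoisson hsmooth _⟩

theorem proposition4p15
    {ED : Type*} [NormedAddCommGroup ED] [NormedSpace ℝ ED] [FiniteDimensional ℝ ED]
    {D : Type*} [TopologicalSpace D] [ChartedSpace ED D] [Group D] [LieGroup 𝓘(ℝ, ED) ∞ D]
    [ConnectedSpace D]
    {EG : Type*} [NormedAddCommGroup EG] [NormedSpace ℝ EG] [FiniteDimensional ℝ EG]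
    {G : Type*} [TopologicalSpace G] [ChartedSpace EG G] [Group G] [LieGroup 𝓘(ℝ, EG) ∞ G]
    [ConnectedSpace G]
    (P : QuasiPoisson.SplitManinPair ED D EG G)
    -- the smooth structure of `S = D / G`: the one for which `D → D / G` is a submersion
    {ES : Type*} [NormedAddCommGroup ES] [NormedSpace ℝ ES] [FiniteDimensional ℝ ES]
    [ChartedSpace ES P.S] [IsManifold 𝓘(ℝ, ES) ∞ P.S]
    (hS_smooth : ContMDiff 𝓘(ℝ, ED) 𝓘(ℝ, ES) ∞ (fun a : D => (a : P.S)))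
    (hS_submersion : ∀ a : D,
      Function.Surjective (mfderiv 𝓘(ℝ, ED) 𝓘(ℝ, ES) (fun a : D => (a : P.S)) a))
    {EM : Type*} [NormedAddCommGroup EM] [NormedSpace ℝ EM] [FiniteDimensional ℝ EM]
    {M : Type*} [TopologicalSpace M] [ChartedSpace EM M] [IsManifold 𝓘(ℝ, EM) ∞ M]
    [T2Space M] [SecondCountableTopology M]
    [MulAction G M] [ContMDiffSMul 𝓘(ℝ, EG) 𝓘(ℝ, EM) ∞ G M]
    (H : QuasiPoisson.HamiltonianSpace P ES EM M)
    (y : P.S) (hy : H.IsRegularValue y) :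
    ∃ br : QuasiPoisson.PoissonBracket (H.invariantFunctions y),
      H.IsReducedBracket br ∧
      (∀ br' : QuasiPoisson.PoissonBracket (H.invariantFunctions y),
        H.IsReducedBracket br' → br' = br) ∧
      -- if `G` acts freely and properly on `J⁻¹(𝒪)`, then `J⁻¹(𝒪) / G` is a Poisson manifold
      ((∀ (g : G) (p : H.Preimage y), g • p = p → g = 1) → ProperSMul G (H.Preimage y) →
        ∃ (d : ℕ) (_ : ChartedSpace (EuclideanSpace ℝ (Fin d)) (H.ReducedSpace y)),
          IsManifold (𝓡 d) ∞ (H.ReducedSpace y) ∧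
          T2Space (H.ReducedSpace y) ∧ SecondCountableTopology (H.ReducedSpace y) ∧
          (∀ h : H.ReducedSpace y → ℝ,
            ContMDiff (𝓡 d) 𝓘(ℝ, ℝ) ∞ h ↔
              QuasiPoisson.HamiltonianSpace.IsSmooth (fun p : H.Preimage y => h (H.proj p))) ∧
          ∃! brQ : QuasiPoisson.PoissonBracket C^∞⟮𝓡 d, H.ReducedSpace y; ℝ⟯,
            ∀ (h k : C^∞⟮𝓡 d, H.ReducedSpace y; ℝ⟯) (f g : H.invariantFunctions y),
              (∀ p, f.1 p = h (H.proj p)) → (∀ p, g.1 p = k (H.proj p)) →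
              ∀ p, brQ.bracket h k (H.proj p) = (br.bracket f g).1 p) :=
  proposition4p15_general P hS_smooth hS_submersion H y hy
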